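/- Let $\alpha\in\mathbb{R}$ and let $$A(x)=\alpha\Big(-\frac{x_2}{x_1^2+x_2^2},\ \frac{x_1}{x_1^2+x_2^2},\ 0,\ 0\Big),\qquad x=(x_1,x_2,x_3,x_4)\in\mathbb{R}^4,\ (x_1,x_2)\neq(0,0),$$ be the Aharonov–Bohm vector potential. Let $\mathcal{L}_A=(-i\nabla+A(x))^2$ be the nonnegative self-adjoint operator on $L^2(\mathbb{R}^4;\mathbb{C})$ which is the Friedrichs extension from $C_c^\infty(\mathbb{R}^4\setminus\{x_1=x_2=0\})$, that is, the operator associated with the closure of the quadratic form $\varphi\mapsto\int_{\mathbb{R}^4}|(-i\nabla+A)\varphi|^2\,dx$ on $C_c^\infty(\mathbb{R}^4\setminus\{x_1=x_2=0\})$. Then, for every $t>0$, the operator $e^{-t\mathcal{L}_A}$ has a measurable integral kernel $e^{-t\mathcal{L}_A}(x,y)$, that is, for every $f\in L^2(\mathbb{R}^4;\mathbb{C})$, $$(e^{-t\mathcal{L}_A}f)(x)=\int_{\mathbb{R}^4}e^{-t\mathcal{L}_A}(x,y)\,f(y)\,dy\qquad\text{for almost every }x\in\mathbb{R}^4,$$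 with an absolutely convergent integral. There is a constant $C$, independent of $t,x,y$, such that this kernel (which is unique up to modification on a set of measure zero) can be chosen with $$\big|e^{-t\mathcal{L}_A}(x,y)\big|\le C\,t^{-2}\,e^{-\frac{|x-y|^2}{4t}}\qquad\text{for all }t>0\text{ and all }x,y\in\mathbb{R}^4.$$ -/

import Mathlib

open MeasureTheory
open scoped ContDiff InnerProductSpace

noncomputable section

namespace AharonovBohm

/-- The space `ℝ⁴` with its Euclidean norm; the coordinates `x₁, x₂, x₃, x₄` are
`x 0, x 1, x 2, x 3`. -/
abbrev R4 : Type := EuclideanSpace ℝ (Fin 4)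

/-- The complex Hilbert space `L²(ℝ⁴; ℂ)`. -/
abbrev L2 : Type := Lp ℂ 2 (volume : Measure R4)

/-- The complex Hilbert space `L²(ℝ⁴; ℂ⁴)`. -/
abbrev L2Vec : Type := Lp (EuclideanSpace ℂ (Fin 4)) 2 (volume : Measure R4)

/-- The complement of the singular plane `{x₁ = x₂ = 0}`. -/
def regularSet : Set R4 := {x | x 0 ≠ 0 ∨ x 1 ≠ 0}

/-- The Aharonov–Bohm vector potential
`A(x) = α (-x₂ / (x₁² + x₂²), x₁ / (x₁² + x₂²), 0, 0)`. -/
def vectorPotential (α : ℝ) (x : R4) : Fin 4 → ℝ :=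
  ![α * (-x 1 / (x 0 ^ 2 + x 1 ^ 2)), α * (x 0 / (x 0 ^ 2 + x 1 ^ 2)), 0, 0]

/-- Test functions: smooth complex valued functions with compact support contained in the
complement of the singular plane. -/
structure IsTest (φ : R4 → ℂ) : Prop where
  smooth : ContDiff ℝ ∞ φ
  compact : HasCompactSupport φ
  subset : tsupport φ ⊆ regularSet

/-- The magnetic gradient `∇_A φ = -i ∇φ + A φ` of a test function. -/
def magGrad (α : ℝ) (φ : R4 → ℂ) (x : R4) : EuclideanSpace ℂ (Fin 4) :=
  WithLp.toLp 2 fun j =>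
    -Complex.I * fderiv ℝ φ x (EuclideanSpace.single j 1) + (vectorPotential α x j : ℂ) * φ x

theorem IsTest.zero : IsTest (0 : R4 → ℂ) where
  smooth := contDiff_const
  compact := HasCompactSupport.zero
  subset := by simp [tsupport]

theorem IsTest.add {φ ψ : R4 → ℂ} (hφ : IsTest φ) (hψ : IsTest ψ) : IsTest (φ + ψ) where
  smooth := hφ.smooth.add hψ.smooth
  compact := hφ.compact.add hψ.compact
  subset := (tsupport_add φ ψ).trans (Set.union_subset hφ.subset hψ.subset)

theorem IsTest.smul (c : ℂ) {φ : R4 → ℂ} (hφ : IsTest φ) : IsTest (c • φ) where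
  smooth := hφ.smooth.const_smul c
  compact := hφ.compact.smul_left (f := fun _ => c)
  subset := (tsupport_smul_subset_right (fun _ => c) φ).trans hφ.subset

theorem IsTest.differentiable {φ : R4 → ℂ} (hφ : IsTest φ) : Differentiable ℝ φ :=
  hφ.smooth.differentiable (by simp)

theorem magGrad_zero (α : ℝ) : magGrad α 0 = 0 := by
  ext x j
  simp [magGrad]

theorem magGrad_add (α : ℝ) {φ ψ : R4 → ℂ} (hφ : IsTest φ) (hψ : IsTest ψ) :
    magGrad α (φ + ψ) = magGrad α φ + magGrad α ψ := by
  ext x j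
  simp only [magGrad, Pi.add_apply, PiLp.add_apply,
    fderiv_add (hφ.differentiable x) (hψ.differentiable x), _root_.add_apply]
  ring

theorem magGrad_smul (α : ℝ) (c : ℂ) {φ : R4 → ℂ} (hφ : IsTest φ) :
    magGrad α (c • φ) = c • magGrad α φ := by
  ext x j
  simp only [magGrad, Pi.smul_apply, PiLp.smul_apply,
    fderiv_const_smul (hφ.differentiable x) c, _root_.smul_apply, smul_eq_mul]
  ring

/-- A test function is square integrable. -/
theorem IsTest.memLp {φ : R4 → ℂ} (hφ : IsTest φ) : MemLp φ 2 (volume : Measure R4) :=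
  hφ.smooth.continuous.memLp_of_hasCompactSupport hφ.compact

theorem IsTest.continuous_magGrad (α : ℝ) {φ : R4 → ℂ} (hφ : IsTest φ) :
    Continuous (magGrad α φ) := by
  refine (PiLp.continuous_toLp 2 _).comp (continuous_pi fun j => Continuous.add ?_ ?_)
  · exact continuous_const.mul
      ((hφ.smooth.continuous_fderiv (by simp)).clm_apply continuous_const)
  · rw [continuous_iff_continuousAt]
    intro x
    by_cases hx : x ∈ tsupport φ
    · have h0 : x 0 ^ 2 + x 1 ^ 2 ≠ 0 := by
        rcases hφ.subset hx with h | h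
        · have := pow_pos (abs_pos.2 h) 2
          rw [sq_abs] at this
          positivity
        · have := pow_pos (abs_pos.2 h) 2
          rw [sq_abs] at this
          positivity
      have h1 : ContinuousAt (fun y => vectorPotential α y j) x := by
        fin_cases j
        · change ContinuousAt (fun y : R4 => α * (-y 1 / (y 0 ^ 2 + y 1 ^ 2))) x
          exact continuousAt_const.mul (ContinuousAt.div (by fun_prop) (by fun_prop) h0)
        · change ContinuousAt (fun y : R4 => α * (y 0 / (y 0 ^ 2 + y 1 ^ 2))) x
          exact continuousAt_const.mul (ContinuousAt.div (by fun_prop) (by fun_prop) h0)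
        · exact continuousAt_const
        · exact continuousAt_const
      exact (Complex.continuous_ofReal.continuousAt.comp h1).mul hφ.smooth.continuous.continuousAt
    · have h := notMem_tsupport_iff_eventuallyEq.1 hx
      refine (continuousAt_const (y := (0 : ℂ))).congr ?_
      filter_upwards [h] with y hy
      simp [hy]

/-- The magnetic gradient of a test function is square integrable. -/
theorem IsTest.memLp_magGrad (α : ℝ) {φ : R4 → ℂ} (hφ : IsTest φ) :
    MemLp (magGrad α φ) 2 (volume : Measure R4) := by
  refine (hφ.continuous_magGrad α).memLp_of_hasCompactSupport ?_
  refine HasCompactSupport.intro hφ.compact fun x hx => ?_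
  have h1 : fderiv ℝ φ x = 0 := by
    by_contra h
    exact hx (support_fderiv_subset ℝ h)
  ext j
  simp [magGrad, h1, image_eq_zero_of_notMem_tsupport hx]

/-- The graph `{(φ, ∇_A φ)}` of the magnetic gradient on test functions, inside
`L²(ℝ⁴; ℂ) ⊕ L²(ℝ⁴; ℂ⁴)`. -/
def gradGraph (α : ℝ) : Submodule ℂ (WithLp 2 (L2 × L2Vec)) where
  carrier := {p | ∃ φ : R4 → ℂ, IsTest φ ∧
    (p.fst : R4 → ℂ) =ᵐ[volume] φ ∧
    (p.snd : R4 → EuclideanSpace ℂ (Fin 4)) =ᵐ[volume] magGrad α φ}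
  zero_mem' := ⟨0, IsTest.zero, Lp.coeFn_zero _ _ _, by
    rw [magGrad_zero]; exact Lp.coeFn_zero _ _ _⟩
  add_mem' := by
    rintro p q ⟨φ, hφ, h1, h2⟩ ⟨ψ, hψ, h3, h4⟩
    refine ⟨φ + ψ, hφ.add hψ, (Lp.coeFn_add _ _).trans (h1.add h3), ?_⟩
    rw [magGrad_add α hφ hψ]
    exact (Lp.coeFn_add _ _).trans (h2.add h4)
  smul_mem' := by
    rintro c p ⟨φ, hφ, h1, h2⟩
    refine ⟨c • φ, hφ.smul c, (Lp.coeFn_smul _ _).trans (h1.const_smul c), ?_⟩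
    rw [magGrad_smul α c hφ]
    exact (Lp.coeFn_smul _ _).trans (h2.const_smul c)

/-- The graph of the closure of the magnetic gradient. Its first projection is the closure of
`C_c^∞(ℝ⁴ \ {x₁ = x₂ = 0})` for the norm `(‖φ‖² + ‖∇_A φ‖²)^(1/2)`, which is the form domain of
the Friedrichs extension. -/
def formGraph (α : ℝ) : Submodule ℂ (WithLp 2 (L2 × L2Vec)) :=
  (gradGraph α).topologicalClosure

/-- The operator `L_A = (-i∇ + A)²`, given through its graph: `IsLA α u w` says that `u` is in the
domain of `L_A` and `L_A u = w`. It is the nonnegative self-adjoint operator of the closed quadratic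
form `u ↦ ‖∇_A u‖²`, that is, the Friedrichs extension of `(-i∇ + A)²` on
`C_c^∞(ℝ⁴ \ {x₁ = x₂ = 0})`: the function `u` lies in the form domain, with magnetic gradient `U`,
and `⟪∇_A v, ∇_A u⟫ = ⟪v, w⟫` for all `v` in the form domain. -/
def IsLA (α : ℝ) (u w : L2) : Prop :=
  ∃ U : L2Vec, WithLp.toLp 2 (u, U) ∈ formGraph α ∧
    ∀ p ∈ formGraph α, ⟪p.snd, U⟫_ℂ = ⟪p.fst, w⟫_ℂ

instance (α : ℝ) : CompleteSpace (formGraph α) :=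
  (gradGraph α).isClosed_topologicalClosure.completeSpace_coe

/-- The resolvent `(1 + L_A)⁻¹`, as a bounded operator on `L²(ℝ⁴; ℂ)`: the vector `(1 + L_A)⁻¹ f`
is the first component of the orthogonal projection of `(f, 0)` onto the graph of the closed
magnetic gradient. The theorem `resolvent_eq_iff` shows that it is the inverse of `1 + L_A`. -/
def resolvent (α : ℝ) : L2 →L[ℂ] L2 :=
  WithLp.fstL 2 ℂ L2 L2Vec ∘L (formGraph α).starProjection ∘L
    (WithLp.prodContinuousLinearEquiv 2 ℂ L2 L2Vec).symm.toContinuousLinearMap ∘L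
      ContinuousLinearMap.inl ℂ L2 L2Vec

theorem resolvent_apply (α : ℝ) (f : L2) :
    resolvent α f = ((formGraph α).starProjection (WithLp.toLp 2 (f, (0 : L2Vec)))).fst := rfl

/-- `(1 + L_A)⁻¹ f = u` if and only if `u` is in the domain of `L_A` and `u + L_A u = f`. -/
theorem resolvent_eq_iff (α : ℝ) (f u : L2) : resolvent α f = u ↔ IsLA α u (f - u) := by
  constructor
  · rintro rfl
    set q := (formGraph α).starProjection (WithLp.toLp 2 (f, (0 : L2Vec))) with hq
    have hmem : q ∈ formGraph α := Submodule.starProjection_apply_mem _ _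
    have horth := Submodule.sub_starProjection_mem_orthogonal (K := formGraph α)
      (WithLp.toLp 2 (f, (0 : L2Vec)))
    refine ⟨q.snd, hmem, fun p hp => ?_⟩
    have h := (Submodule.mem_orthogonal _ _).1 horth p hp
    rw [← hq, WithLp.prod_inner_apply] at h
    change ⟪p.fst, f - q.fst⟫_ℂ + ⟪p.snd, 0 - q.snd⟫_ℂ = 0 at h
    rw [zero_sub, inner_neg_right, ← sub_eq_add_neg, sub_eq_zero] at h
    rw [resolvent_apply, ← hq]
    exact h.symm
  · rintro ⟨U, hU, h⟩
    have key : (formGraph α).starProjection (WithLp.toLp 2 (f, (0 : L2Vec)))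
        = WithLp.toLp 2 (u, U) := by
      refine Submodule.eq_starProjection_of_mem_orthogonal hU ?_
      rw [Submodule.mem_orthogonal]
      intro p hp
      rw [WithLp.prod_inner_apply]
      change ⟪p.fst, f - u⟫_ℂ + ⟪p.snd, 0 - U⟫_ℂ = 0
      rw [zero_sub, inner_neg_right, h p hp, ← sub_eq_add_neg, sub_self]
    rw [resolvent_apply, key]
    rfl

/-- The resolvent is self-adjoint, so the continuous functional calculus applies to it. -/
theorem isSelfAdjoint_resolvent (α : ℝ) : IsSelfAdjoint (resolvent α) := by
  rw [ContinuousLinearMap.isSelfAdjoint_iff_isSymmetric]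
  intro f g
  have h := Submodule.inner_starProjection_left_eq_right (formGraph α)
    (WithLp.toLp 2 (f, (0 : L2Vec))) (WithLp.toLp 2 (g, (0 : L2Vec)))
  rw [WithLp.prod_inner_apply, WithLp.prod_inner_apply] at h
  change ⟪resolvent α f, g⟫_ℂ + ⟪_, (0 : L2Vec)⟫_ℂ = ⟪f, resolvent α g⟫_ℂ + ⟪(0 : L2Vec), _⟫_ℂ at h
  rw [inner_zero_right, inner_zero_left, add_zero, add_zero] at h
  exact h

/-- The function `μ ↦ exp (-t (1/μ - 1))` for `μ > 0`, extended by `0` to `μ ≤ 0`. It expresses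
`exp (-t λ)` through the value `μ = 1 / (1 + λ)` of the resolvent. -/
def heatSymbol (t μ : ℝ) : ℝ := if 0 < μ then Real.exp (-t * (1 / μ - 1)) else 0

theorem heatSymbol_inv (t l : ℝ) (hl : 0 ≤ l) : heatSymbol t (1 / (1 + l)) = Real.exp (-t * l) := by
  have h : 0 < 1 / (1 + l) := by positivity
  rw [heatSymbol, if_pos h, one_div_one_div]
  congr 1
  ring

theorem continuous_heatSymbol {t : ℝ} (ht : 0 < t) : Continuous (heatSymbol t) := by
  have h : heatSymbol t = fun μ => Real.exp t * expNegInvGlue (μ / t) := by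
    funext μ
    unfold heatSymbol expNegInvGlue
    by_cases hμ : 0 < μ
    · rw [if_pos hμ, if_neg (not_le.2 (div_pos hμ ht)), ← Real.exp_add]
      congr 1
      field_simp
      ring
    · rw [if_neg hμ, if_pos (div_nonpos_of_nonpos_of_nonneg (not_lt.1 hμ) ht.le), mul_zero]
  rw [h]
  exact continuous_const.mul
    ((expNegInvGlue.contDiff (n := 0)).continuous.comp (continuous_id.div_const t))

/-- The operator `exp (-t L)`, for `t > 0`, of a nonnegative self-adjoint operator `L` in a complex
Hilbert space with resolvent `R = (1 + L)⁻¹`. It is given by the functional calculus in the form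
`exp (-t L) = g_t (R)`, where `g_t (1 / (1 + λ)) = exp (-t λ)` for `λ ≥ 0`. -/
def heatOfResolvent {H : Type*} [NormedAddCommGroup H] [InnerProductSpace ℂ H] [CompleteSpace H]
    (R : H →L[ℂ] H) (t : ℝ) : H →L[ℂ] H := cfc (heatSymbol t) R

/-- The heat semigroup `exp (-t L_A)`, for `t > 0`, as a bounded operator on `L²(ℝ⁴; ℂ)`. -/
def heatOp (α t : ℝ) : L2 →L[ℂ] L2 := heatOfResolvent (resolvent α) t

/-- `K` is an integral kernel of the bounded operator `T`: it is measurable and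
`(T f)(x) = ∫ K(x, y) f(y) dy`, as an absolutely convergent integral, for almost every `x`, for
every `f` in `L²`. -/
def IsIntegralKernel (T : L2 →L[ℂ] L2) (K : R4 → R4 → ℂ) : Prop :=
  Measurable (Function.uncurry K) ∧
    ∀ f : L2, ∀ᵐ x : R4, Integrable (fun y => K x y * f y) ∧ T f x = ∫ y, K x y * f y

end AharonovBohm

end

/-!
The heat semigroup of the Aharonov–Bohm operator is dominated by the heat semigroup of `ℝ⁴`
(diamagnetic inequality): `|exp (-t L_A) f| ≤ C p_t * |f|` almost everywhere, where
`p_t z = t⁻² exp (-|z|² / (4 t))` is the heat kernel up to normalisation. An operator on `L²`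
dominated by a positive kernel with bounded `L²` norms has itself a measurable kernel with the same
bound, so the domination gives the theorem.

The domination rests on Kato's inequality. Write `N z = √(|z|² + ε²)`. For a test function `φ` and a
smooth weight `ψ ≥ 0`, the function `ψ φ / N φ` is again a test function, since it vanishes near the
singular plane wherever `φ` does. The vector potential is real, so `re (φ̄ ∇φ)` and with it
`∇ (N φ)` can be read off from the magnetic gradient, and `|∇ (N φ)| ≤ |∇_A φ|`. Hence
`re ⟪∇_A (ψ φ / N φ), ∇_A φ⟫ ≥ ∫ ∇ψ · ∇(N φ) = - ∫ Δψ (N φ - ε)`. Passing to the closure of the form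
gives `- ∫ Δψ (N u - ε) ≤ re ∫ ψ ū (L_A u) / N u` for every `u` in the domain of `L_A`
(`IsLA.kato`). No capacity of the singular plane enters, and `ψ` need not vanish there.

Now let `u s = exp (-s L_A) f`, and let `ψ s = p_{τ - s} (· - y)` solve the backward heat equation.
By Kato's inequality, `∫ ψ s (N (u s) - ε)` has a nonpositive derivative in `s`
(`exists_hasDerivAt_comparison`). Comparing the times `0` and `t`, with `τ = t + δ`, and letting
`ε → 0` gives `∫ p_δ (x - y) |u t x| dx ≤ ∫ p_{t + δ} (x - y) |f x| dx` for all `y` and `δ > 0`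
(`inner_gaussLp_absLp_heatOp_le`). As `p_δ` is bounded below by a constant times the normalised
indicator of the ball of radius `√δ`, the Lebesgue differentiation theorem gives the domination as
`δ → 0` (`ae_norm_heatOp_apply_le`). The constant lost here is harmless, while the exponent is
untouched.

The kernel of a dominated operator `T` is `∑ i, (T e_i)(x) conj (e_i y)` for a Hilbert basis `e`:
the domination makes evaluation at almost every point a bounded functional, so that `T` is
Hilbert–Schmidt into `L²` of a finite measure (`exists_kernel_of_norm_apply_le`).
-/

noncomputable section

namespace AharonovBohm

open Filter Topology ComplexConjugate

/-! ### Integral kernels of dominated operators -/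

section Kernel

variable {X : Type*} [MeasurableSpace X] {μ : Measure X}

/-- Pointwise Bessel inequality: if `|T f| ≤ M ‖f‖` almost everywhere for each `f`, evaluation of
`T f` at almost every point is a functional of norm at most `M`. -/
theorem sum_norm_sq_apply_le (T : Lp ℂ 2 μ →L[ℂ] Lp ℂ 2 μ) {M : ℝ}
    (hT : ∀ f, ∀ᵐ x ∂μ, ‖T f x‖ ≤ M * ‖f‖) {ι : Type*} {e : ι → Lp ℂ 2 μ}
    (he : Orthonormal ℂ e) (s : Finset ι) :
    ∀ᵐ x ∂μ, ∑ i ∈ s, ‖T (e i) x‖ ^ 2 ≤ M ^ 2 := by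
  -- countably many coefficient vectors suffice, so that one null set serves all of them
  set D := TopologicalSpace.denseSeq (EuclideanSpace ℂ s) with hD
  have h1 : ∀ k, ∀ᵐ x ∂μ, ‖∑ i : s, D k i * T (e i) x‖ ≤ M * ‖D k‖ := by
    intro k
    have h2 : T (∑ i : s, D k i • e i) = ∑ i : s, D k i • T (e i) := by simp
    have h3 : ‖∑ i : s, D k i • e i‖ = ‖D k‖ := by
      rw [← sq_eq_sq₀ (norm_nonneg _) (norm_nonneg _), ← Complex.ofReal_inj]
      have h5 := (he.comp _ (Subtype.val_injective (p := fun i => i ∈ s))).inner_sum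
        (D k) (D k) Finset.univ
      have h6 := inner_self_eq_norm_sq_to_K (𝕜 := ℂ) (∑ i : s, D k i • e i)
      have h7 := inner_self_eq_norm_sq_to_K (𝕜 := ℂ) (D k)
      rw [PiLp.inner_apply] at h7
      push_cast
      refine h6.symm.trans ((h5.trans ?_).trans h7)
      exact Finset.sum_congr rfl fun i _ => by
        rw [RCLike.inner_apply, mul_comm]
    have h4 : ∀ᵐ x ∂μ, ∀ i : s, (D k i • T (e i)) x = D k i * T (e i) x := by
      rw [ae_all_iff]
      intro i
      filter_upwards [Lp.coeFn_smul (D k i) (T (e i))] with x hx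
      rw [hx]; rfl
    filter_upwards [hT (∑ i : s, D k i • e i),
      Lp.coeFn_fun_finsetSum Finset.univ (fun i : s => D k i • T (e i)), h4] with x ha hb hc
    rw [h2, h3, hb] at ha
    simpa only [hc] using ha
  filter_upwards [ae_all_iff.2 h1] with x hx
  have h2 : ∀ c : EuclideanSpace ℂ s, ‖∑ i : s, c i * T (e i) x‖ ≤ M * ‖c‖ := by
    intro c
    have hcl : IsClosed {c : EuclideanSpace ℂ s | ‖∑ i : s, c i * T (e i) x‖ ≤ M * ‖c‖} :=
      isClosed_le (by fun_prop) (by fun_prop)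
    exact (TopologicalSpace.denseRange_denseSeq (EuclideanSpace ℂ s)).induction_on c hcl hx
  -- the coefficients `conj (T e_i x)` give `S ≤ M √S`
  have h3 := h2 (WithLp.toLp 2 fun i => conj (T (e i) x))
  set S := ∑ i ∈ s, ‖T (e i) x‖ ^ 2 with hS
  have hS0 : 0 ≤ S := Finset.sum_nonneg fun i _ => by positivity
  have h4 : ‖∑ i : s, conj (T (e i) x) * T (e i) x‖ = S := by
    have : ∑ i : s, conj (T (e i) x) * T (e i) x = ((S : ℝ) : ℂ) := by
      rw [hS, ← Finset.sum_coe_sort s]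
      push_cast
      exact Finset.sum_congr rfl fun i _ => by rw [Complex.conj_mul']
    rw [this, Complex.norm_of_nonneg hS0]
  have h5 : ‖(WithLp.toLp 2 fun i : s => conj (T (e i) x) : EuclideanSpace ℂ s)‖ = √S := by
    rw [EuclideanSpace.norm_eq, hS, ← Finset.sum_coe_sort s]
    simp
  change ‖∑ i : s, conj (T (e i) x) * T (e i) x‖ ≤ _ at h3
  rw [h4, h5] at h3
  rcases hS0.eq_or_lt with h | h
  · rw [← h]; positivity
  · have h6 := Real.sqrt_pos.2 h
    have h7 := Real.mul_self_sqrt hS0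
    have h8 : √S ≤ M := by
      by_contra! hlt
      nlinarith
    nlinarith

theorem memLp_mul_prod {Y : Type*} [MeasurableSpace Y] {ν : Measure Y} [SFinite μ] [SFinite ν]
    {f : Y → ℂ} {g : X → ℂ} (hf : MemLp f 2 ν) (hg : MemLp g 2 μ) :
    MemLp (fun z : Y × X => f z.1 * g z.2) 2 (ν.prod μ) := by
  have hm : AEStronglyMeasurable (fun z : Y × X => f z.1 * g z.2) (ν.prod μ) :=
    hf.1.comp_fst.mul hg.1.comp_snd
  rw [memLp_two_iff_integrable_sq_norm hm]
  have := ((memLp_two_iff_integrable_sq_norm hf.1).1 hf).mul_prod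
    ((memLp_two_iff_integrable_sq_norm hg.1).1 hg)
  simpa [mul_pow] using this

theorem memLp_conj {f : X → ℂ} (hf : MemLp f 2 μ) : MemLp (fun x => conj (f x)) 2 μ :=
  hf.star

theorem inner_eq_of_ae_eq_mul_prod {Y : Type*} [MeasurableSpace Y] {ν : Measure Y} [SFinite μ]
    [SFinite ν] {F G : Lp ℂ 2 (ν.prod μ)} {a c : Y → ℂ} {b d : X → ℂ}
    (hF : F =ᵐ[ν.prod μ] fun z => a z.1 * conj (b z.2))
    (hG : G =ᵐ[ν.prod μ] fun z => c z.1 * conj (d z.2)) :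
    ⟪F, G⟫_ℂ = (∫ x, conj (a x) * c x ∂ν) * ∫ y, conj (d y) * b y ∂μ := by
  rw [L2.inner_def, ← integral_prod_mul]
  refine integral_congr_ae ?_
  filter_upwards [hF, hG] with z h1 h2
  rw [h2, h1, RCLike.inner_apply, map_mul, Complex.conj_conj]
  ring

/-- The functions `(x, y) ↦ (T e_i)(x) conj (e_i y)`, for an orthonormal family `e`, are orthogonal
and square summable in `L²` of the product once the first factor carries a finite measure. -/
theorem summable_tensor [SFinite μ] {ν : Measure X} [IsFiniteMeasure ν]
    (hac : ν ≪ μ) {T : Lp ℂ 2 μ →L[ℂ] Lp ℂ 2 μ} {M : ℝ}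
    (hT : ∀ f, ∀ᵐ x ∂μ, ‖T f x‖ ≤ M * ‖f‖) {ι : Type*} {e : ι → Lp ℂ 2 μ}
    (he : Orthonormal ℂ e) {V : ι → Lp ℂ 2 (ν.prod μ)}
    (hV : ∀ i, V i =ᵐ[ν.prod μ] fun z => T (e i) z.1 * conj (e i z.2)) :
    Summable V := by
  have hTL : ∀ f, MemLp (T f) 2 ν := fun f =>
    MemLp.of_bound (Lp.stronglyMeasurable (T f)).aestronglyMeasurable _ (hac.ae_le (hT f))
  have hin2 : ∀ i j, ⟪V i, V j⟫_ℂ = (∫ x, conj (T (e i) x) * T (e j) x ∂ν) * ⟪e j, e i⟫_ℂ := by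
    intro i j
    rw [inner_eq_of_ae_eq_mul_prod (hV i) (hV j), L2.inner_def]
    simp only [RCLike.inner_apply, mul_comm]
  have horth : OrthogonalFamily ℂ (fun i => (ℂ ∙ V i : Submodule ℂ (Lp ℂ 2 (ν.prod μ))))
      fun i => (ℂ ∙ V i).subtypeₗᵢ := by
    refine OrthogonalFamily.of_pairwise fun i j hij => ?_
    change (ℂ ∙ V i) ⟂ (ℂ ∙ V j)
    rw [Submodule.isOrtho_span]
    rintro _ rfl _ rfl
    rw [hin2, he.2 hij.symm, mul_zero]
  have hnorm : ∀ i, ‖V i‖ ^ 2 = ∫ x, ‖T (e i) x‖ ^ 2 ∂ν := by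
    intro i
    have h1 := inner_self_eq_norm_sq_to_K (𝕜 := ℂ) (V i)
    rw [hin2, inner_self_eq_norm_sq_to_K, he.1 i] at h1
    have h2 : ∫ x, conj (T (e i) x) * T (e i) x ∂ν = ((∫ x, ‖T (e i) x‖ ^ 2 ∂ν : ℝ) : ℂ) := by
      rw [← integral_complex_ofReal]
      exact integral_congr_ae (ae_of_all _ fun x => by simp [Complex.conj_mul'])
    rw [h2] at h1
    have h3 : ((‖V i‖ ^ 2 : ℝ) : ℂ) = ((∫ x, ‖T (e i) x‖ ^ 2 ∂ν : ℝ) : ℂ) := by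
      rw [← mul_one ((∫ x, ‖T (e i) x‖ ^ 2 ∂ν : ℝ) : ℂ)]
      simpa using h1.symm
    exact_mod_cast h3
  have h1 := (horth.summable_iff_norm_sq_summable
    (fun i => ⟨V i, Submodule.mem_span_singleton_self _⟩)).2
  refine h1 (summable_of_sum_le (c := M ^ 2 * ν.real Set.univ) (fun i => by positivity) ?_)
  intro s
  have hint : ∀ i ∈ s, Integrable (fun x => ‖T (e i) x‖ ^ 2) ν := fun i _ =>
    (memLp_two_iff_integrable_sq_norm (hTL _).1).1 (hTL _)
  calc ∑ i ∈ s, ‖V i‖ ^ 2 = ∫ x, ∑ i ∈ s, ‖T (e i) x‖ ^ 2 ∂ν := by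
        rw [integral_finsetSum _ hint]
        exact Finset.sum_congr rfl fun i _ => hnorm i
    _ ≤ ∫ _, M ^ 2 ∂ν := integral_mono_ae (integrable_finsetSum _ hint) (integrable_const _)
        (hac.ae_le (sum_norm_sq_apply_le T hT he s))
    _ = M ^ 2 * ν.real Set.univ := by simp [mul_comm]

/-- The kernel is the sum `∑ i, (T e_i)(x) conj (e_i y)` over a Hilbert basis. -/
theorem exists_kernel_of_norm_apply_le [SigmaFinite μ] (T : Lp ℂ 2 μ →L[ℂ] Lp ℂ 2 μ) {M : ℝ}
    (hT : ∀ f, ∀ᵐ x ∂μ, ‖T f x‖ ≤ M * ‖f‖) :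
    ∃ K : X → X → ℂ, Measurable (Function.uncurry K) ∧ (∀ᵐ x ∂μ, MemLp (K x) 2 μ) ∧
      ∀ f : Lp ℂ 2 μ, ∀ᵐ x ∂μ, T f x = ∫ y, K x y * f y ∂μ := by
  obtain ⟨w, e, -⟩ := exists_hilbertBasis ℂ (Lp ℂ 2 μ)
  -- a finite measure with the same null sets, for which `T f` is square integrable
  set ν := μ.toFinite with hν
  have hae : ae ν = ae μ := ae_toFinite
  have hac : ν ≪ μ := toFinite_absolutelyContinuous μ
  have hT' : ∀ f, ∀ᵐ x ∂ν, ‖T f x‖ ≤ M * ‖f‖ := fun f => hac.ae_le (hT f)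
  have hTL : ∀ f, MemLp (T f) 2 ν := fun f =>
    MemLp.of_bound (Lp.stronglyMeasurable (T f)).aestronglyMeasurable _ (hT' f)
  have hem : ∀ f : Lp ℂ 2 μ, MemLp (fun y => conj (f y)) 2 μ := fun f => memLp_conj (Lp.memLp f)
  have hVm : ∀ i, MemLp (fun z : X × X => T (e i) z.1 * conj (e i z.2)) 2 (ν.prod μ) :=
    fun i => memLp_mul_prod (hTL _) (hem _)
  obtain ⟨Kp, hK⟩ := summable_tensor hac hT e.orthonormal fun i => (hVm i).coeFn_toLp
  have hKL := Lp.memLp Kp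
  have hKs : ∀ᵐ x ∂ν, MemLp (fun y => Kp (x, y)) 2 μ := by
    have h1 := ((memLp_two_iff_integrable_sq_norm hKL.1).1 hKL).prod_right_ae
    filter_upwards [h1] with x hx
    rw [memLp_two_iff_integrable_sq_norm]
    · exact hx
    · exact ((Lp.stronglyMeasurable Kp).comp_measurable measurable_prodMk_left).aestronglyMeasurable
  refine ⟨fun x y => Kp (x, y), (Lp.stronglyMeasurable Kp).measurable, by rw [← hae]; exact hKs,
    fun f => ?_⟩
  rw [← hae]
  -- pair the kernel with `1_B ⊗ conj f`
  have hprod : ∀ B : Set X, MeasurableSet B →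
      MemLp (fun z : X × X => B.indicator (fun _ => (1 : ℂ)) z.1 * conj (f z.2)) 2 (ν.prod μ) :=
    fun B hB => memLp_mul_prod (memLp_indicator_const _ hB _ (Or.inr (measure_ne_top _ _))) (hem f)
  have hint : ∀ B : Set X, MeasurableSet B → Integrable
      (fun z : X × X => B.indicator (fun _ => (1 : ℂ)) z.1 * (Kp z * f z.2)) (ν.prod μ) := by
    intro B hB
    refine (MemLp.integrable_mul hKL (memLp_conj (hprod B hB))).congr (ae_of_all _ fun z => ?_)
    by_cases hz : z.1 ∈ B <;> simp [hz]
  have hint1 : Integrable (fun x => ∫ y, Kp (x, y) * f y ∂μ) ν := by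
    have := (hint Set.univ MeasurableSet.univ).integral_prod_left
    simpa using this
  refine Integrable.ae_eq_of_forall_setIntegral_eq _ _ ((hTL f).integrable (by norm_num)) hint1
    fun B hB _ => ?_
  have hL : ⟪(hprod B hB).toLp, Kp⟫_ℂ = ∫ x in B, ∫ y, Kp (x, y) * f y ∂μ ∂ν := by
    rw [L2.inner_def, ← integral_indicator hB]
    have h1 : ∫ z, ⟪(hprod B hB).toLp _ z, Kp z⟫_ℂ ∂(ν.prod μ)
        = ∫ z, B.indicator (fun _ => (1 : ℂ)) z.1 * (Kp z * f z.2) ∂(ν.prod μ) := by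
      refine integral_congr_ae ?_
      filter_upwards [(hprod B hB).coeFn_toLp] with z hz
      rw [hz, RCLike.inner_apply]
      by_cases hzB : z.1 ∈ B <;> simp [hzB]
    rw [h1, integral_prod _ (hint B hB)]
    refine integral_congr_ae (ae_of_all _ fun x => ?_)
    by_cases hx : x ∈ B <;> simp [hx]
  have hTint : ∀ g, Integrable (T g) ν := fun g => (hTL g).integrable (by norm_num)
  let Λ : Lp ℂ 2 μ →L[ℂ] ℂ := LinearMap.mkContinuous
    { toFun := fun g => ∫ x in B, T g x ∂ν
      map_add' := fun g h => by
        rw [← integral_add (hTint g).integrableOn (hTint h).integrableOn, map_add]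
        exact integral_congr_ae (ae_restrict_of_ae (hac.ae_le (Lp.coeFn_add (T g) (T h))))
      map_smul' := fun c g => by
        rw [RingHom.id_apply, map_smul, ← integral_smul]
        exact integral_congr_ae (ae_restrict_of_ae (hac.ae_le (Lp.coeFn_smul c (T g)))) }
    (M * ν.real B) fun g => by
      have := norm_setIntegral_le_of_norm_le_const_ae' (f := T g) (measure_lt_top ν B)
        ((hT' g).mono fun x hx _ => hx)
      rw [mul_right_comm]
      exact this
  have hΛ : ∀ g, Λ g = ∫ x in B, T g x ∂ν := fun g => rfl
  have h1 := hK.mapL (innerSL ℂ ((hprod B hB).toLp))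
  have h2 := (e.hasSum_repr f).mapL Λ
  have h3 : ∀ i, innerSL ℂ ((hprod B hB).toLp) ((hVm i).toLp) = Λ (e.repr f i • e i) := by
    intro i
    rw [innerSL_apply_apply,
      inner_eq_of_ae_eq_mul_prod (hprod B hB).coeFn_toLp (hVm i).coeFn_toLp,
      e.repr_apply_apply, map_smul, smul_eq_mul, mul_comm, L2.inner_def, hΛ,
      ← integral_indicator hB]
    congr 1
    · simp only [RCLike.inner_apply, mul_comm]
    · refine integral_congr_ae (ae_of_all _ fun x => ?_)
      by_cases hx : x ∈ B <;> simp [hx]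
  rw [← hΛ, ← hL]
  simp_rw [h3] at h1
  exact h2.unique h1

/-- A pointwise domination of the operator passes to its kernel. -/
theorem ae_norm_kernel_le [MeasurableSpace.CountablyGenerated X] [SigmaFinite μ]
    {T : Lp ℂ 2 μ →L[ℂ] Lp ℂ 2 μ} {q : X → X → ℝ}
    (hq0 : ∀ x y, 0 ≤ q x y) (hq : ∀ x, MemLp (q x) 2 μ)
    (hT : ∀ f, ∀ᵐ x ∂μ, ‖T f x‖ ≤ ∫ y, q x y * ‖f y‖ ∂μ) {K : X → X → ℂ}
    (hK : Measurable (Function.uncurry K)) (hK2 : ∀ᵐ x ∂μ, MemLp (K x) 2 μ)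
    (hTK : ∀ f : Lp ℂ 2 μ, ∀ᵐ x ∂μ, T f x = ∫ y, K x y * f y ∂μ) :
    ∀ᵐ x ∂μ, ∀ᵐ y ∂μ, ‖K x y‖ ≤ q x y := by
  have : Fact ((2 : ENNReal) ≠ ⊤) := ⟨by norm_num⟩
  -- the bound on a dense sequence extends to all of `L²` by continuity, with one null set
  have h1 : ∀ᵐ x ∂μ, ∀ k, ‖∫ y, K x y * TopologicalSpace.denseSeq (Lp ℂ 2 μ) k y ∂μ‖
      ≤ ∫ y, q x y * ‖TopologicalSpace.denseSeq (Lp ℂ 2 μ) k y‖ ∂μ := by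
    rw [ae_all_iff]
    intro k
    filter_upwards [hT (TopologicalSpace.denseSeq (Lp ℂ 2 μ) k),
      hTK (TopologicalSpace.denseSeq (Lp ℂ 2 μ) k)] with x hx1 hx2
    rwa [← hx2]
  filter_upwards [h1, hK2] with x hx hKx
  have hfix : ∀ f : Lp ℂ 2 μ, ‖∫ y, K x y * f y ∂μ‖ ≤ ∫ y, q x y * ‖f y‖ ∂μ := by
    have hl : ∀ f : Lp ℂ 2 μ,
        ∫ y, K x y * f y ∂μ = ⟪(memLp_conj hKx).toLp, f⟫_ℂ := by
      intro f
      rw [L2.inner_def]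
      refine integral_congr_ae ?_
      filter_upwards [(memLp_conj hKx).coeFn_toLp] with y hy
      rw [hy, RCLike.inner_apply]
      simp [mul_comm]
    have hr : ∀ f : Lp ℂ 2 μ, ∫ y, q x y * ‖f y‖ ∂μ
        = ⟪(hq x).toLp, lipschitzWith_one_norm.compLp norm_zero f⟫_ℝ := by
      intro f
      rw [L2.inner_def]
      refine integral_congr_ae ?_
      filter_upwards [(hq x).coeFn_toLp,
        lipschitzWith_one_norm.coeFn_compLp norm_zero f] with y hy hy2
      rw [hy, hy2]
      simp [mul_comm]
    intro f
    have hcl : IsClosed {f : Lp ℂ 2 μ | ‖∫ y, K x y * f y ∂μ‖ ≤ ∫ y, q x y * ‖f y‖ ∂μ} := by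
      simp_rw [hl, hr]
      exact isClosed_le (by fun_prop)
        (continuous_const.inner (lipschitzWith_one_norm.continuous_compLp norm_zero))
    exact (TopologicalSpace.denseRange_denseSeq (Lp ℂ 2 μ)).induction_on f hcl hx
  have hmx : Measurable (K x) := hK.comp measurable_prodMk_left
  -- test with `f = 1_A conj K(x, ·)`, where `A = {|K(x, ·)| > q(x, ·)}`
  obtain ⟨q', hq'm, hq'⟩ := (hq x).1
  set A : Set X := {y | q' y < ‖K x y‖} with hA
  have hAm : MeasurableSet A := measurableSet_lt hq'm.measurable hmx.norm
  have hfm : MemLp (A.indicator fun y => conj (K x y)) 2 μ := (memLp_conj hKx).indicator hAm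
  have h2 := hfix hfm.toLp
  have hq'L : MemLp q' 2 μ := (memLp_congr_ae hq').1 (hq x)
  have h3 : ∫ y, K x y * hfm.toLp _ y ∂μ
      = ((∫ y, A.indicator (fun y => ‖K x y‖ ^ 2) y ∂μ : ℝ) : ℂ) := by
    rw [← integral_complex_ofReal]
    refine integral_congr_ae ?_
    filter_upwards [hfm.coeFn_toLp] with y hy
    rw [hy]
    by_cases hyA : y ∈ A
    · simp [hyA, Complex.mul_conj']
    · simp [hyA]
  have h4 : ∫ y, q x y * ‖hfm.toLp _ y‖ ∂μ = ∫ y, A.indicator (fun y => q' y * ‖K x y‖) y ∂μ := by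
    refine integral_congr_ae ?_
    filter_upwards [hfm.coeFn_toLp, hq'] with y hy hy2
    rw [hy, hy2]
    by_cases hyA : y ∈ A
    · simp [hyA]
    · simp [hyA]
  rw [h3, h4, Complex.norm_of_nonneg
    (integral_nonneg fun y => Set.indicator_nonneg (fun _ _ => by positivity) y)] at h2
  have hi1 : Integrable (A.indicator (fun y => ‖K x y‖ ^ 2)) μ :=
    ((memLp_two_iff_integrable_sq_norm hKx.1).1 hKx).indicator hAm
  have hi2 : Integrable (A.indicator (fun y => q' y * ‖K x y‖)) μ :=
    (MemLp.integrable_mul hq'L hKx.norm).indicator hAm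
  have h6 : 0 ≤ᵐ[μ] fun y => A.indicator (fun y => ‖K x y‖ ^ 2) y
      - A.indicator (fun y => q' y * ‖K x y‖) y := by
    refine ae_of_all _ fun y => ?_
    by_cases hyA : y ∈ A
    · have : q' y < ‖K x y‖ := hyA
      simp only [hyA, Set.indicator_of_mem, Pi.zero_apply]
      nlinarith [norm_nonneg (K x y)]
    · simp [hyA]
  have h7 := (integral_eq_zero_iff_of_nonneg_ae h6 (hi1.sub hi2)).1
    (le_antisymm (by rw [integral_sub hi1 hi2]; linarith) (integral_nonneg_of_ae h6))
  filter_upwards [h7, hq'] with y hy hy2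
  rw [hy2]
  by_contra! hlt
  have hyA : y ∈ A := hlt
  simp only [hyA, Set.indicator_of_mem, Pi.zero_apply] at hy
  have := hq0 x y
  nlinarith [norm_nonneg (K x y)]

/-- An operator on `L²` dominated by a positive kernel `q` with bounded `L²` norms of `q(x, ·)` has
a measurable kernel bounded by `q` everywhere. -/
theorem exists_kernel_norm_le [MeasurableSpace.CountablyGenerated X] [SigmaFinite μ]
    (T : Lp ℂ 2 μ →L[ℂ] Lp ℂ 2 μ) {q : X → X → ℝ} (hqm : Measurable (Function.uncurry q))
    (hq0 : ∀ x y, 0 ≤ q x y) (hq : ∀ x, MemLp (q x) 2 μ) {M : ℝ}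
    (hM : ∀ x, ‖(hq x).toLp‖ ≤ M)
    (hT : ∀ f, ∀ᵐ x ∂μ, ‖T f x‖ ≤ ∫ y, q x y * ‖f y‖ ∂μ) :
    ∃ K : X → X → ℂ, Measurable (Function.uncurry K) ∧ (∀ x y, ‖K x y‖ ≤ q x y) ∧
      ∀ f : Lp ℂ 2 μ, ∀ᵐ x ∂μ,
        Integrable (fun y => K x y * f y) μ ∧ T f x = ∫ y, K x y * f y ∂μ := by
  have hb : ∀ f, ∀ᵐ x ∂μ, ‖T f x‖ ≤ M * ‖f‖ := by
    intro f
    filter_upwards [hT f] with x hx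
    refine hx.trans ?_
    have hr : ∫ y, q x y * ‖f y‖ ∂μ
        = ⟪(hq x).toLp, lipschitzWith_one_norm.compLp norm_zero f⟫_ℝ := by
      rw [L2.inner_def]
      refine integral_congr_ae ?_
      filter_upwards [(hq x).coeFn_toLp,
        lipschitzWith_one_norm.coeFn_compLp norm_zero f] with y hy hy2
      rw [hy, hy2]
      simp [mul_comm]
    rw [hr]
    refine (real_inner_le_norm _ _).trans ?_
    have := lipschitzWith_one_norm.norm_compLp_le norm_zero f
    rw [NNReal.coe_one, one_mul] at this
    exact mul_le_mul (hM x) this (norm_nonneg _) ((norm_nonneg _).trans (hM x))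
  obtain ⟨K, hK, hK2, hTK⟩ := exists_kernel_of_norm_apply_le T hb
  have hle := ae_norm_kernel_le hq0 hq hT hK hK2 hTK
  have hS : MeasurableSet {z : X × X | ‖Function.uncurry K z‖ ≤ Function.uncurry q z} :=
    measurableSet_le hK.norm hqm
  -- on the null set where the bound fails, the kernel is replaced by `0`
  refine ⟨fun x y => {z : X × X | ‖Function.uncurry K z‖ ≤ Function.uncurry q z}.indicator
    (Function.uncurry K) (x, y), hK.indicator hS, fun x y => ?_, fun f => ?_⟩
  · by_cases h : ‖K x y‖ ≤ q x y
    · simp [Set.indicator, h]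
    · simpa [Set.indicator, h] using hq0 x y
  · filter_upwards [hK2, hle, hTK f] with x h1 h2 h3
    have h4 : (fun y => K x y * f y) =ᵐ[μ] fun y =>
        {z : X × X | ‖Function.uncurry K z‖ ≤ Function.uncurry q z}.indicator
          (Function.uncurry K) (x, y) * f y := by
      filter_upwards [h2] with y hy
      simp [Set.indicator, hy]
    exact ⟨(MemLp.integrable_mul h1 (Lp.memLp f)).congr h4, h3.trans (integral_congr_ae h4)⟩

end Kernel

/-! ### The smooth modulus -/

/-- The smooth modulus `√(|z|² + ε²)`. -/
def smoothAbs (ε : ℝ) (z : ℂ) : ℝ := √(‖z‖ ^ 2 + ε ^ 2)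

theorem smoothAbs_sq (ε : ℝ) (z : ℂ) : smoothAbs ε z ^ 2 = ‖z‖ ^ 2 + ε ^ 2 :=
  Real.sq_sqrt (by positivity)

theorem norm_le_smoothAbs (ε : ℝ) (z : ℂ) : ‖z‖ ≤ smoothAbs ε z :=
  Real.le_sqrt_of_sq_le (by nlinarith [sq_nonneg ε])

theorem le_smoothAbs (ε : ℝ) (z : ℂ) : ε ≤ smoothAbs ε z :=
  Real.le_sqrt_of_sq_le (by nlinarith [sq_nonneg ‖z‖])

theorem smoothAbs_pos {ε : ℝ} (hε : 0 < ε) (z : ℂ) : 0 < smoothAbs ε z :=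
  hε.trans_le (le_smoothAbs ε z)

theorem smoothAbs_zero {ε : ℝ} (hε : 0 ≤ ε) : smoothAbs ε 0 = ε := by
  simp [smoothAbs, Real.sqrt_sq hε]

theorem smoothAbs_le_add (ε : ℝ) (z w : ℂ) : smoothAbs ε z ≤ smoothAbs ε w + ‖z - w‖ := by
  have h0 : 0 ≤ smoothAbs ε w := Real.sqrt_nonneg _
  have h1 := norm_le_smoothAbs ε w
  have h2 : ‖z‖ ≤ ‖w‖ + ‖z - w‖ := by simpa using norm_add_le w (z - w)
  have h3 := smoothAbs_sq ε w
  refine Real.sqrt_le_iff.2 ⟨by positivity, ?_⟩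
  nlinarith [norm_nonneg z, norm_nonneg w, norm_nonneg (z - w),
    mul_le_mul_of_nonneg_right h1 (norm_nonneg (z - w))]

theorem smoothAbs_le_norm_add {ε : ℝ} (hε : 0 ≤ ε) (z : ℂ) : smoothAbs ε z ≤ ‖z‖ + ε := by
  simpa [smoothAbs_zero hε, add_comm] using smoothAbs_le_add ε z 0

theorem abs_smoothAbs_sub_le (ε : ℝ) (z w : ℂ) : |smoothAbs ε z - smoothAbs ε w| ≤ ‖z - w‖ := by
  rw [abs_le]
  have h1 := smoothAbs_le_add ε z w
  have h2 := smoothAbs_le_add ε w z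
  rw [norm_sub_rev] at h2
  constructor <;> linarith

theorem lipschitzWith_smoothAbs_sub (ε : ℝ) : LipschitzWith 1 fun z => smoothAbs ε z - ε :=
  LipschitzWith.of_dist_le_mul fun z w => by
    rw [Real.dist_eq, dist_eq_norm, NNReal.coe_one, one_mul]
    simpa using abs_smoothAbs_sub_le ε z w

theorem smoothAbs_sub_zero {ε : ℝ} (hε : 0 ≤ ε) : smoothAbs ε 0 - ε = 0 := by
  rw [smoothAbs_zero hε, sub_self]

theorem contDiff_smoothAbs {ε : ℝ} (hε : 0 < ε) : ContDiff ℝ ∞ (smoothAbs ε) :=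
  ((contDiff_norm_sq ℝ).add contDiff_const).sqrt fun z => by positivity

/-- The smooth sign `z / √(|z|² + ε²)`. -/
def smoothSign (ε : ℝ) (z : ℂ) : ℂ := (smoothAbs ε z)⁻¹ • z

theorem smoothSign_zero (ε : ℝ) : smoothSign ε 0 = 0 := smul_zero _

theorem lipschitzWith_smoothSign {ε : ℝ} (hε : 0 < ε) :
    LipschitzWith (2 / ε).toNNReal (smoothSign ε) :=
  LipschitzWith.of_dist_le_mul fun z w => by
    rw [dist_eq_norm, dist_eq_norm, Real.coe_toNNReal _ (by positivity)]
    have hz := smoothAbs_pos hε z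
    have hw := smoothAbs_pos hε w
    have h1 : smoothSign ε z - smoothSign ε w = (smoothAbs ε z)⁻¹ • (z - w)
        + ((smoothAbs ε w - smoothAbs ε z) * (smoothAbs ε z)⁻¹ * (smoothAbs ε w)⁻¹) • w := by
      have : (smoothAbs ε w - smoothAbs ε z) * (smoothAbs ε z)⁻¹ * (smoothAbs ε w)⁻¹
          = (smoothAbs ε z)⁻¹ - (smoothAbs ε w)⁻¹ := by field_simp
      rw [this, smoothSign, smoothSign, smul_sub, sub_smul]
      abel
    have h2 : (smoothAbs ε z)⁻¹ ≤ ε⁻¹ := inv_anti₀ hε (le_smoothAbs ε z)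
    have h3 : (smoothAbs ε w)⁻¹ * ‖w‖ ≤ 1 := by
      rw [inv_mul_le_one₀ hw]; exact norm_le_smoothAbs ε w
    have h4 := abs_smoothAbs_sub_le ε w z
    rw [norm_sub_rev] at h4
    rw [h1]
    refine (norm_add_le _ _).trans ?_
    rw [norm_smul, norm_smul, Real.norm_eq_abs, Real.norm_eq_abs, abs_mul, abs_mul,
      abs_of_pos (inv_pos.2 hz), abs_of_pos (inv_pos.2 hw)]
    have h5 : (smoothAbs ε z)⁻¹ * ‖z - w‖ ≤ ε⁻¹ * ‖z - w‖ := by gcongr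
    have h6 : |smoothAbs ε w - smoothAbs ε z| * (smoothAbs ε z)⁻¹ * (smoothAbs ε w)⁻¹ * ‖w‖
        ≤ ‖z - w‖ * ε⁻¹ * 1 := by
      rw [mul_assoc _ _ ‖w‖]
      gcongr
    calc _ ≤ ε⁻¹ * ‖z - w‖ + ‖z - w‖ * ε⁻¹ * 1 := add_le_add h5 h6
      _ = _ := by ring

/-- Second order Taylor estimate for the smooth modulus. -/
theorem abs_smoothAbs_taylor_le {ε : ℝ} (hε : 0 < ε) (z w : ℂ) :
    |smoothAbs ε w - smoothAbs ε z - (conj (smoothSign ε z) * (w - z)).re| ≤ ‖w - z‖ ^ 2 / ε := by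
  set a := smoothAbs ε z with ha
  set b := smoothAbs ε w with hb
  have ha0 : 0 < a := smoothAbs_pos hε z
  have hb0 : 0 < b := smoothAbs_pos hε w
  set r := (conj z * (w - z)).re with hr
  have h1 : (conj (smoothSign ε z) * (w - z)).re = r / a := by
    rw [smoothSign, ← ha, hr, Complex.real_smul, map_mul, Complex.conj_ofReal, mul_assoc,
      Complex.re_ofReal_mul]
    ring
  have h2 : b ^ 2 - a ^ 2 = 2 * r + ‖w - z‖ ^ 2 := by
    rw [ha, hb, smoothAbs_sq, smoothAbs_sq, hr, Complex.sq_norm, Complex.sq_norm, Complex.sq_norm]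
    simp [Complex.normSq_apply]
    ring
  have h3 : |r| ≤ a * ‖w - z‖ := by
    refine (Complex.abs_re_le_norm _).trans ?_
    rw [norm_mul, Complex.norm_conj]
    gcongr
    exact norm_le_smoothAbs ε z
  have h4 : |b - a| ≤ ‖w - z‖ := abs_smoothAbs_sub_le ε w z
  have h5 : b - a - r / a = (‖w - z‖ ^ 2 * a - r * (b - a)) / ((a + b) * a) := by
    field_simp
    linear_combination a * h2
  rw [h1, h5, abs_div, abs_of_pos (by positivity : 0 < (a + b) * a), div_le_div_iff₀
    (by positivity) hε]
  have h6 : |‖w - z‖ ^ 2 * a - r * (b - a)| ≤ 2 * a * ‖w - z‖ ^ 2 := by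
    refine (abs_sub _ _).trans ?_
    rw [abs_mul r, abs_of_nonneg (by positivity : 0 ≤ ‖w - z‖ ^ 2 * a)]
    have := mul_le_mul h3 h4 (abs_nonneg _) (by positivity)
    nlinarith
  have hεa : ε ≤ a := le_smoothAbs ε z
  have hεb : ε ≤ b := le_smoothAbs ε w
  calc _ ≤ 2 * a * ‖w - z‖ ^ 2 * ε := by gcongr
    _ = ‖w - z‖ ^ 2 * ((ε + ε) * a) := by ring
    _ ≤ _ := by gcongr

/-- The algebra behind Kato's inequality, for one component of the gradient: `φ`, `m` and `ρ` are
the values of a function, of a component of its magnetic gradient, and of its smooth modulus,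
`ψ` and `dψ` those of a weight and its partial derivative, `(re (i φ̄ m)) / ρ` is the partial
derivative of the smooth modulus, and the first argument of the product on the right is the
component of the magnetic gradient of `ψ φ / ρ`. -/
theorem kato_algebra (φ m : ℂ) {ρ ψ : ℝ} (dψ : ℝ) (hρ : 0 < ρ) (hφ : ‖φ‖ ≤ ρ) (hψ : 0 ≤ ψ) {d : ℝ}
    (hd : d = (Complex.I * conj φ * m).re / ρ) :
    dψ * d ≤ (conj (-Complex.I * ((dψ / ρ - ψ * d / ρ ^ 2 : ℝ) * φ) + (ψ / ρ : ℝ) * m) * m).re := by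
  have h1 : (Complex.I * conj φ * m).re = ρ * d := by rw [hd]; field_simp
  have h2 : (conj (-Complex.I * ((dψ / ρ - ψ * d / ρ ^ 2 : ℝ) * φ) + (ψ / ρ : ℝ) * m) * m).re
      = (dψ / ρ - ψ * d / ρ ^ 2) * (ρ * d) + ψ / ρ * ‖m‖ ^ 2 := by
    rw [← h1, Complex.sq_norm, Complex.normSq_apply]
    generalize dψ / ρ - ψ * d / ρ ^ 2 = a
    generalize ψ / ρ = b
    simp
    ring
  have h3 : |d| ≤ ‖m‖ := by
    rw [hd, abs_div, abs_of_pos hρ, div_le_iff₀ hρ]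
    refine (Complex.abs_re_le_norm _).trans ?_
    rw [norm_mul, norm_mul, Complex.norm_I, Complex.norm_conj, one_mul, mul_comm]
    gcongr
  have h4 : d ^ 2 ≤ ‖m‖ ^ 2 := by rw [← sq_abs]; gcongr
  have h5 : (dψ / ρ - ψ * d / ρ ^ 2) * (ρ * d) + ψ / ρ * ‖m‖ ^ 2
      = dψ * d + ψ / ρ * (‖m‖ ^ 2 - d ^ 2) := by field_simp; ring
  rw [h2, h5]
  have : 0 ≤ ψ / ρ * (‖m‖ ^ 2 - d ^ 2) := mul_nonneg (by positivity) (by linarith)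
  linarith

/-- The bound on the magnetic gradient of `ψ φ / ρ`, with the notation of `kato_algebra`, that
allows passing to the limit in the test function. -/
theorem kato_norm_le (φ m : ℂ) {ρ ψ ε M : ℝ} {dψ : ℝ} (hε : 0 < ε) (hρ : ε ≤ ρ) (hφ : ‖φ‖ ≤ ρ)
    (hψ : 0 ≤ ψ) (hψM : ψ ≤ M) (hdM : |dψ| ≤ M) {d : ℝ}
    (hd : d = (Complex.I * conj φ * m).re / ρ) :
    ‖-Complex.I * ((dψ / ρ - ψ * d / ρ ^ 2 : ℝ) * φ) + (ψ / ρ : ℝ) * m‖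
      ≤ 2 * M / ε * (‖φ‖ + ‖m‖) := by
  have hρ0 : 0 < ρ := hε.trans_le hρ
  have h3 : |d| ≤ ‖m‖ := by
    rw [hd, abs_div, abs_of_pos hρ0, div_le_iff₀ hρ0]
    refine (Complex.abs_re_le_norm _).trans ?_
    rw [norm_mul, norm_mul, Complex.norm_I, Complex.norm_conj, one_mul, mul_comm]
    gcongr
  have hM : 0 ≤ M := hψ.trans hψM
  have h4 : |dψ / ρ - ψ * d / ρ ^ 2| * ‖φ‖ ≤ M / ε * ‖φ‖ + M / ε * ‖m‖ := by
    have h5 : |dψ / ρ - ψ * d / ρ ^ 2| ≤ |dψ| / ρ + ψ * |d| / ρ ^ 2 := by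
      refine (abs_sub _ _).trans_eq ?_
      rw [abs_div, abs_div, abs_mul, abs_of_pos hρ0, abs_of_nonneg hψ, abs_of_pos (pow_pos hρ0 2)]
    calc _ ≤ (|dψ| / ρ + ψ * |d| / ρ ^ 2) * ‖φ‖ := by gcongr
      _ = |dψ| / ρ * ‖φ‖ + ψ / ρ * |d| * (‖φ‖ / ρ) := by field_simp
      _ ≤ M / ε * ‖φ‖ + M / ε * ‖m‖ * 1 := by
          have : ‖φ‖ / ρ ≤ 1 := (div_le_one hρ0).2 hφ
          gcongr
      _ = _ := by ring
  refine (norm_add_le _ _).trans ?_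
  rw [norm_mul, norm_mul, norm_mul, norm_neg, Complex.norm_I, one_mul, Complex.norm_real,
    Complex.norm_real, Real.norm_eq_abs, Real.norm_eq_abs,
    abs_of_nonneg (by positivity : 0 ≤ ψ / ρ)]
  have h6 : ψ / ρ * ‖m‖ ≤ M / ε * ‖m‖ := by gcongr
  have h7 : 0 ≤ M / ε * ‖φ‖ := by positivity
  calc _ ≤ M / ε * ‖φ‖ + M / ε * ‖m‖ + M / ε * ‖m‖ := add_le_add h4 h6
    _ ≤ _ := by
      have : 2 * M / ε * (‖φ‖ + ‖m‖) = M / ε * ‖φ‖ + M / ε * ‖m‖ + M / ε * ‖m‖ + M / ε * ‖φ‖ := by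
        ring
      linarith

/-! ### Kato's inequality for test functions -/

section KatoTest

/-- The Laplacian `∑ j, ∂_j² ψ`. -/
def lapl (ψ : R4 → ℝ) (x : R4) : ℝ :=
  ∑ j : Fin 4, fderiv ℝ (fun z => fderiv ℝ ψ z (EuclideanSpace.single j 1)) x
    (EuclideanSpace.single j 1)

/-- Nonnegative smooth weights, bounded by `M` together with their first derivatives, with square
integrable Laplacian. -/
structure IsWeight (ψ : R4 → ℝ) (M : ℝ) : Prop where
  smooth : ContDiff ℝ ∞ ψ
  nonneg : ∀ x, 0 ≤ ψ x
  le : ∀ x, ψ x ≤ M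
  fderiv_le : ∀ x j, |fderiv ℝ ψ x (EuclideanSpace.single j 1)| ≤ M
  memLp_lapl : MemLp (lapl ψ) 2 (volume : Measure R4)

/-- The test function `ψ φ / √(|φ|² + ε²)` of Kato's inequality. -/
def katoTest (ε : ℝ) (ψ : R4 → ℝ) (φ : R4 → ℂ) (x : R4) : ℂ := (ψ x / smoothAbs ε (φ x)) • φ x

variable {α ε M : ℝ} {ψ : R4 → ℝ} {φ : R4 → ℂ}

theorem IsTest.contDiff_smoothAbs (hφ : IsTest φ) (hε : 0 < ε) :
    ContDiff ℝ ∞ fun x => smoothAbs ε (φ x) :=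
  (AharonovBohm.contDiff_smoothAbs hε).comp hφ.smooth

theorem IsTest.katoTest (hφ : IsTest φ) (hε : 0 < ε) (hψ : ContDiff ℝ ∞ ψ) :
    IsTest (katoTest ε ψ φ) where
  smooth := (hψ.div (hφ.contDiff_smoothAbs hε) fun _ => (smoothAbs_pos hε _).ne').smul hφ.smooth
  compact := hφ.compact.smul_left (f := fun x => ψ x / smoothAbs ε (φ x))
  subset := (tsupport_smul_subset_right (fun x => ψ x / smoothAbs ε (φ x)) φ).trans hφ.subset

theorem fderiv_smoothAbs_comp (hε : 0 < ε) {x : R4} (hφ : DifferentiableAt ℝ φ x) (v : R4) :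
    fderiv ℝ (fun x => smoothAbs ε (φ x)) x v
      = (conj (φ x) * fderiv ℝ φ x v).re / smoothAbs ε (φ x) := by
  have h1 : HasFDerivAt (fun x => ‖φ x‖ ^ 2 + ε ^ 2) _ x :=
    hφ.hasFDerivAt.norm_sq.add_const (ε ^ 2)
  have h2 := h1.sqrt (by positivity)
  change fderiv ℝ (fun x => √(‖φ x‖ ^ 2 + ε ^ 2)) x v = _
  rw [h2.fderiv]
  simp only [_root_.smul_apply, ContinuousLinearMap.comp_apply, innerSL_apply_apply,
    Complex.inner, smul_eq_mul, nsmul_eq_mul, smoothAbs]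
  have : 0 < √(‖φ x‖ ^ 2 + ε ^ 2) := smoothAbs_pos hε (φ x)
  push_cast
  field_simp

/-- The partial derivatives of the smooth modulus in terms of the magnetic gradient: the vector
potential drops out since it is real. -/
theorem fderiv_smoothAbs_eq_magGrad (hφ : IsTest φ) (hε : 0 < ε) (x : R4) (j : Fin 4) :
    fderiv ℝ (fun x => smoothAbs ε (φ x)) x (EuclideanSpace.single j 1)
      = (Complex.I * conj (φ x) * magGrad α φ x j).re / smoothAbs ε (φ x) := by
  rw [fderiv_smoothAbs_comp hε (hφ.differentiable x)]
  congr 1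
  simp [magGrad]
  ring

theorem magGrad_katoTest (hφ : IsTest φ) (hε : 0 < ε) (hψ : ContDiff ℝ ∞ ψ) (x : R4) (j : Fin 4) :
    magGrad α (katoTest ε ψ φ) x j
      = -Complex.I * ((fderiv ℝ ψ x (EuclideanSpace.single j 1) / smoothAbs ε (φ x)
          - ψ x * fderiv ℝ (fun x => smoothAbs ε (φ x)) x (EuclideanSpace.single j 1)
            / smoothAbs ε (φ x) ^ 2 : ℝ) * φ x)
        + (ψ x / smoothAbs ε (φ x) : ℝ) * magGrad α φ x j := by
  have h1 : HasFDerivAt (fun x => smoothAbs ε (φ x)) _ x :=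
    ((hφ.contDiff_smoothAbs hε).differentiable (by simp) x).hasFDerivAt
  have h2 : HasFDerivAt ψ _ x := (hψ.differentiable (by simp) x).hasFDerivAt
  have hpos := smoothAbs_pos hε (φ x)
  have h3' := (h2.mul ((hasDerivAt_inv hpos.ne').comp_hasFDerivAt x h1))
  have h3 := HasFDerivAt.smul h3' (hφ.differentiable x).hasFDerivAt
  have h4 : fderiv ℝ (katoTest ε ψ φ) x (EuclideanSpace.single j 1)
      = (ψ x / smoothAbs ε (φ x)) • fderiv ℝ φ x (EuclideanSpace.single j 1)
        + (fderiv ℝ ψ x (EuclideanSpace.single j 1) / smoothAbs ε (φ x)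
          - ψ x * fderiv ℝ (fun x => smoothAbs ε (φ x)) x (EuclideanSpace.single j 1)
            / smoothAbs ε (φ x) ^ 2) • φ x := by
    have h5 : fderiv ℝ (katoTest ε ψ φ) x = _ := h3.fderiv
    rw [h5]
    simp
    field_simp
    ring
  simp only [magGrad, h4, katoTest, Complex.real_smul]
  ring

/-- Kato's inequality for test functions. -/
theorem neg_integral_lapl_mul_le (hφ : IsTest φ) (hε : 0 < ε) (hψ : IsWeight ψ M) :
    -∫ x, lapl ψ x * (smoothAbs ε (φ x) - ε)
      ≤ ∫ x, (⟪magGrad α (katoTest ε ψ φ) x, magGrad α φ x⟫_ℂ).re := by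
  set N : R4 → ℝ := fun x => smoothAbs ε (φ x) - ε with hN
  have hNs : ContDiff ℝ ∞ N := (hφ.contDiff_smoothAbs hε).sub contDiff_const
  have hNc : HasCompactSupport N :=
    hφ.compact.comp_left (g := fun z => smoothAbs ε z - ε) (smoothAbs_sub_zero hε.le)
  have hdN : ∀ x, fderiv ℝ N x = fderiv ℝ (fun x => smoothAbs ε (φ x)) x := fun x =>
    fderiv_sub_const ε
  set D : Fin 4 → R4 → ℝ := fun j z => fderiv ℝ ψ z (EuclideanSpace.single j 1) with hD
  have hDs : ∀ j, ContDiff ℝ ∞ (D j) := fun j =>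
    (hψ.smooth.fderiv_right (m := ∞) (by simp)).clm_apply contDiff_const
  have hdNs : ∀ j, Continuous fun x => fderiv ℝ N x (EuclideanSpace.single j 1) := fun j =>
    (hNs.continuous_fderiv (by simp)).clm_apply continuous_const
  have hdNc : ∀ j, HasCompactSupport fun x => fderiv ℝ N x (EuclideanSpace.single j 1) := fun j =>
    hNc.fderiv_apply (𝕜 := ℝ) _
  have hi1 : ∀ j, Integrable fun x => fderiv ℝ (D j) x (EuclideanSpace.single j 1) * N x := fun j =>
    ((((hDs j).continuous_fderiv (by simp)).clm_apply continuous_const).mul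
      hNs.continuous).integrable_of_hasCompactSupport hNc.mul_left
  have hi2 : ∀ j, Integrable fun x => D j x * fderiv ℝ N x (EuclideanSpace.single j 1) := fun j =>
    ((hDs j).continuous.mul (hdNs j)).integrable_of_hasCompactSupport (hdNc j).mul_left
  have hi3 : ∀ j, Integrable fun x => D j x * N x := fun j =>
    ((hDs j).continuous.mul hNs.continuous).integrable_of_hasCompactSupport hNc.mul_left
  have h1 : -∫ x, lapl ψ x * N x
      = ∫ x, ∑ j, D j x * fderiv ℝ N x (EuclideanSpace.single j 1) := by
    simp_rw [lapl, Finset.sum_mul]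
    rw [integral_finsetSum _ fun j _ => hi1 j, integral_finsetSum _ fun j _ => hi2 j,
      ← Finset.sum_neg_distrib]
    refine Finset.sum_congr rfl fun j _ => ?_
    rw [integral_mul_fderiv_eq_neg_fderiv_mul_of_integrable (hi1 j) (hi2 j) (hi3 j)
      (fun x _ => (hDs j).differentiable (by simp) x) fun x _ => hNs.differentiable (by simp) x]
  rw [h1]
  refine integral_mono (integrable_finsetSum _ fun j _ => hi2 j) ?_ fun x => ?_
  · have h2 := (hφ.katoTest hε hψ.smooth).memLp_magGrad α
    have h3 := hφ.memLp_magGrad α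
    have h4 : Integrable fun x => ⟪magGrad α (katoTest ε ψ φ) x, magGrad α φ x⟫_ℂ := by
      refine (L2.integrable_inner (𝕜 := ℂ) h2.toLp h3.toLp).congr ?_
      filter_upwards [h2.coeFn_toLp, h3.coeFn_toLp] with x hx1 hx2
      rw [hx1, hx2]
    exact h4.re
  · simp only [PiLp.inner_apply, Complex.re_sum]
    refine Finset.sum_le_sum fun j _ => ?_
    rw [RCLike.inner_apply, mul_comm (magGrad α φ x j), magGrad_katoTest hφ hε hψ.smooth, hdN]
    exact kato_algebra _ _ _ (smoothAbs_pos hε _) (norm_le_smoothAbs _ _) (hψ.nonneg x)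
      (fderiv_smoothAbs_eq_magGrad hφ hε x j)

end KatoTest

/-! ### Kato's inequality on the domain of the magnetic operator -/

section KatoDomain

variable {α ε M : ℝ} {ψ : R4 → ℝ} {φ : R4 → ℂ}

/-- The function `√(|u|² + ε²) - ε` as an element of `L²`. -/
def smoothAbsLp (ε : ℝ) (hε : 0 ≤ ε) (u : L2) : Lp ℝ 2 (volume : Measure R4) :=
  (lipschitzWith_smoothAbs_sub ε).compLp (smoothAbs_sub_zero hε) u

theorem coeFn_smoothAbsLp (hε : 0 ≤ ε) (u : L2) :
    smoothAbsLp ε hε u =ᵐ[volume] fun x => smoothAbs ε (u x) - ε :=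
  (lipschitzWith_smoothAbs_sub ε).coeFn_compLp (smoothAbs_sub_zero hε) u

theorem continuous_smoothAbsLp (hε : 0 ≤ ε) : Continuous (smoothAbsLp ε hε) :=
  (lipschitzWith_smoothAbs_sub ε).continuous_compLp (smoothAbs_sub_zero hε)

theorem norm_smoothAbsLp_sub_le (hε : 0 ≤ ε) (u v : L2) :
    ‖smoothAbsLp ε hε u - smoothAbsLp ε hε v‖ ≤ ‖u - v‖ := by
  have h := (lipschitzWith_smoothAbs_sub ε).norm_compLp_sub_le (smoothAbs_sub_zero hε) u v
  rw [NNReal.coe_one, one_mul] at h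
  exact h

/-- The function `u / √(|u|² + ε²)` as an element of `L²`. -/
def smoothSignLp (ε : ℝ) (hε : 0 < ε) (u : L2) : L2 :=
  (lipschitzWith_smoothSign hε).compLp (smoothSign_zero ε) u

theorem coeFn_smoothSignLp (hε : 0 < ε) (u : L2) :
    smoothSignLp ε hε u =ᵐ[volume] fun x => smoothSign ε (u x) :=
  (lipschitzWith_smoothSign hε).coeFn_compLp (smoothSign_zero ε) u

theorem continuous_smoothSignLp (hε : 0 < ε) : Continuous (smoothSignLp ε hε) :=
  (lipschitzWith_smoothSign hε).continuous_compLp (smoothSign_zero ε)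

theorem IsWeight.memLp_smul (hψ : IsWeight ψ M) (w : L2) :
    MemLp (fun x => ψ x • w x) 2 (volume : Measure R4) := by
  refine (Lp.memLp w).of_le_mul (c := M)
    (hψ.smooth.continuous.aestronglyMeasurable.smul (Lp.memLp w).1) (ae_of_all _ fun x => ?_)
  rw [norm_smul, Real.norm_eq_abs, abs_of_nonneg (hψ.nonneg x)]
  exact mul_le_mul_of_nonneg_right (hψ.le x) (norm_nonneg _)

theorem inner_smoothSignLp (hψ : IsWeight ψ M) (hε : 0 < ε) (u w : L2) :
    (⟪smoothSignLp ε hε u, (hψ.memLp_smul w).toLp⟫_ℂ).re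
      = ∫ x, ψ x * (conj (smoothSign ε (u x)) * w x).re := by
  rw [L2.inner_def, ← RCLike.re_eq_complex_re, ← integral_re (L2.integrable_inner _ _)]
  refine integral_congr_ae ?_
  filter_upwards [coeFn_smoothSignLp hε u, (hψ.memLp_smul w).coeFn_toLp] with x h1 h2
  rw [h1, h2, RCLike.inner_apply, RCLike.re_eq_complex_re, Complex.real_smul, mul_assoc,
    Complex.re_ofReal_mul, mul_comm (w x)]

theorem inner_smoothAbsLp {g : R4 → ℝ} (hg : MemLp g 2 (volume : Measure R4)) (hε : 0 ≤ ε)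
    (u : L2) : ⟪hg.toLp, smoothAbsLp ε hε u⟫_ℝ = ∫ x, g x * (smoothAbs ε (u x) - ε) := by
  rw [L2.inner_def]
  refine integral_congr_ae ?_
  filter_upwards [coeFn_smoothAbsLp hε u, hg.coeFn_toLp] with x h1 h2
  rw [h1, h2, RCLike.inner_apply, mul_comm]
  rfl

theorem norm_magGrad_katoTest_le (hφ : IsTest φ) (hε : 0 < ε) (hψ : IsWeight ψ M) (x : R4) :
    ‖magGrad α (katoTest ε ψ φ) x‖ ≤ 8 * M / ε * (‖φ x‖ + ‖magGrad α φ x‖) := by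
  have hM : 0 ≤ M := (hψ.nonneg x).trans (hψ.le x)
  have h1 : ∀ j, ‖magGrad α (katoTest ε ψ φ) x j‖ ≤ 2 * M / ε * (‖φ x‖ + ‖magGrad α φ x‖) := by
    intro j
    rw [magGrad_katoTest hφ hε hψ.smooth]
    refine (kato_norm_le _ _ hε (le_smoothAbs _ _) (norm_le_smoothAbs _ _) (hψ.nonneg x)
      (hψ.le x) (hψ.fderiv_le x j) (fderiv_smoothAbs_eq_magGrad (α := α) hφ hε x j)).trans ?_
    gcongr
    exact PiLp.norm_apply_le _ j
  have h2 : ‖magGrad α (katoTest ε ψ φ) x‖ ≤ ∑ j, ‖magGrad α (katoTest ε ψ φ) x j‖ := by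
    have h3 : magGrad α (katoTest ε ψ φ) x
        = ∑ j, EuclideanSpace.single j (magGrad α (katoTest ε ψ φ) x j) := by
      ext i
      simp [Finset.sum_apply, Pi.single_apply]
    conv_lhs => rw [h3]
    exact (norm_sum_le _ _).trans_eq (Finset.sum_congr rfl fun j _ => by simp)
  refine h2.trans ((Finset.sum_le_sum fun j _ => h1 j).trans_eq ?_)
  simp
  ring

/-- Kato's inequality: `Δ √(|u|² + ε²) ≥ - re (ū L_A u) / √(|u|² + ε²)`, in weak form. -/
theorem IsLA.kato {u w : L2} (h : IsLA α u w) (hε : 0 < ε) (hψ : IsWeight ψ M) :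
    -∫ x, lapl ψ x * (smoothAbs ε (u x) - ε) ≤ ∫ x, ψ x * (conj (smoothSign ε (u x)) * w x).re := by
  obtain ⟨U, hU, horth⟩ := h
  have hU' : WithLp.toLp 2 (u, U) ∈ closure (gradGraph α : Set (WithLp 2 (L2 × L2Vec))) := by
    rw [← Submodule.topologicalClosure_coe]; exact hU
  -- `φ k → u` and `∇_A φ k → U`, with `V k = ψ φ k / √(|φ k|² + ε²)` and `W k = ∇_A (V k)`;
  -- the `W k` need only be bounded, since they are paired with `∇_A φ k - U → 0`
  obtain ⟨p, hp, hlim⟩ := mem_closure_iff_seq_limit.1 hU'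
  have hfst : Tendsto (fun k => (p k).fst) atTop (𝓝 u) :=
    ((WithLp.fstL 2 ℂ L2 L2Vec).continuous.tendsto _).comp hlim
  have hsnd : Tendsto (fun k => (p k).snd) atTop (𝓝 U) :=
    ((WithLp.sndL 2 ℂ L2 L2Vec).continuous.tendsto _).comp hlim
  choose φ hφ hφ1 hφ2 using hp
  have hv : ∀ k, IsTest (katoTest ε ψ (φ k)) := fun k => (hφ k).katoTest hε hψ.smooth
  set V : ℕ → L2 := fun k => (hv k).memLp.toLp with hV
  set W : ℕ → L2Vec := fun k => ((hv k).memLp_magGrad α).toLp with hW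
  have hVW : ∀ k, ⟪W k, U⟫_ℂ = ⟪V k, w⟫_ℂ := fun k =>
    horth (WithLp.toLp 2 (V k, W k)) ((gradGraph α).le_topologicalClosure
      ⟨_, hv k, (hv k).memLp.coeFn_toLp, ((hv k).memLp_magGrad α).coeFn_toLp⟩)
  have hVin : ∀ k, ⟪V k, w⟫_ℂ = ⟪smoothSignLp ε hε (p k).fst, (hψ.memLp_smul w).toLp⟫_ℂ := by
    intro k
    rw [L2.inner_def, L2.inner_def]
    refine integral_congr_ae ?_
    filter_upwards [(hv k).memLp.coeFn_toLp, coeFn_smoothSignLp hε (p k).fst,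
      (hψ.memLp_smul w).coeFn_toLp, hφ1 k] with x h1 h2 h3 h4
    rw [hV, h1, h2, h3, h4, katoTest, smoothSign, RCLike.inner_apply, RCLike.inner_apply]
    simp only [Complex.real_smul, map_mul, Complex.conj_ofReal, div_eq_mul_inv, Complex.ofReal_mul]
    ring
  have hWn : ∀ k, ‖W k‖ ≤ 8 * M / ε * (‖(p k).fst‖ + ‖(p k).snd‖) := by
    intro k
    set g : Lp ℝ 2 (volume : Measure R4) := lipschitzWith_one_norm.compLp norm_zero (p k).fst
      + lipschitzWith_one_norm.compLp norm_zero (p k).snd with hg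
    have hM : 0 ≤ M := (hψ.nonneg 0).trans (hψ.le 0)
    have h1 : ‖W k‖ ≤ 8 * M / ε * ‖g‖ := by
      refine Lp.norm_le_mul_norm_of_ae_le_mul ?_
      filter_upwards [((hv k).memLp_magGrad α).coeFn_toLp, hφ1 k, hφ2 k, Lp.coeFn_add
        (lipschitzWith_one_norm.compLp norm_zero (p k).fst)
        (lipschitzWith_one_norm.compLp norm_zero (p k).snd),
        lipschitzWith_one_norm.coeFn_compLp norm_zero (p k).fst,
        lipschitzWith_one_norm.coeFn_compLp norm_zero (p k).snd] with x h1 h2 h3 h4 h5 h6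
      rw [hW, h1, hg, h4, Pi.add_apply, h5, h6, Function.comp_apply, Function.comp_apply, h2, h3,
        Real.norm_of_nonneg (by positivity)]
      exact norm_magGrad_katoTest_le (hφ k) hε hψ x
    have h2 : ‖g‖ ≤ ‖(p k).fst‖ + ‖(p k).snd‖ := by
      refine (norm_add_le _ _).trans (add_le_add ?_ ?_)
      · simpa using lipschitzWith_one_norm.norm_compLp_le norm_zero (p k).fst
      · simpa using lipschitzWith_one_norm.norm_compLp_le norm_zero (p k).snd
    exact h1.trans (by gcongr)
  have hineq : ∀ k, -⟪hψ.memLp_lapl.toLp, smoothAbsLp ε hε.le (p k).fst⟫_ℝ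
      ≤ (⟪smoothSignLp ε hε (p k).fst, (hψ.memLp_smul w).toLp⟫_ℂ).re
        + 8 * M / ε * (‖(p k).fst‖ + ‖(p k).snd‖) * ‖(p k).snd - U‖ := by
    intro k
    have h1 := neg_integral_lapl_mul_le (α := α) (hφ k) hε hψ
    have h2 : ⟪hψ.memLp_lapl.toLp, smoothAbsLp ε hε.le (p k).fst⟫_ℝ
        = ∫ x, lapl ψ x * (smoothAbs ε (φ k x) - ε) := by
      rw [inner_smoothAbsLp]
      refine integral_congr_ae ?_
      filter_upwards [hφ1 k] with x hx
      rw [hx]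
    have h3 : (⟪W k, (p k).snd⟫_ℂ).re
        = ∫ x, (⟪magGrad α (katoTest ε ψ (φ k)) x, magGrad α (φ k) x⟫_ℂ).re := by
      rw [L2.inner_def, ← RCLike.re_eq_complex_re, ← integral_re (L2.integrable_inner _ _)]
      refine integral_congr_ae ?_
      filter_upwards [((hv k).memLp_magGrad α).coeFn_toLp, hφ2 k] with x h1 h2
      rw [hW, h1, h2]
    have h4 : ⟪W k, (p k).snd⟫_ℂ = ⟪V k, w⟫_ℂ + ⟪W k, (p k).snd - U⟫_ℂ := by
      rw [inner_sub_right, hVW]; ring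
    have h5 : (⟪W k, (p k).snd - U⟫_ℂ).re
        ≤ 8 * M / ε * (‖(p k).fst‖ + ‖(p k).snd‖) * ‖(p k).snd - U‖ :=
      (Complex.re_le_norm _).trans ((norm_inner_le_norm _ _).trans (by gcongr; exact hWn k))
    rw [h2]
    refine h1.trans ?_
    rw [← h3, h4, Complex.add_re, hVin]
    linarith
  rw [← inner_smoothAbsLp hψ.memLp_lapl hε.le, ← inner_smoothSignLp hψ hε]
  have hL : Tendsto (fun k => -⟪hψ.memLp_lapl.toLp, smoothAbsLp ε hε.le (p k).fst⟫_ℝ) atTop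
      (𝓝 (-⟪hψ.memLp_lapl.toLp, smoothAbsLp ε hε.le u⟫_ℝ)) :=
    (tendsto_const_nhds.inner (((continuous_smoothAbsLp hε.le).tendsto u).comp hfst)).neg
  have hR : Tendsto (fun k => (⟪smoothSignLp ε hε (p k).fst, (hψ.memLp_smul w).toLp⟫_ℂ).re
        + 8 * M / ε * (‖(p k).fst‖ + ‖(p k).snd‖) * ‖(p k).snd - U‖) atTop
      (𝓝 ((⟪smoothSignLp ε hε u, (hψ.memLp_smul w).toLp⟫_ℂ).re
        + 8 * M / ε * (‖u‖ + ‖U‖) * ‖U - U‖)) :=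
    ((Complex.continuous_re.tendsto _).comp
      ((((continuous_smoothSignLp hε).tendsto u).comp hfst).inner tendsto_const_nhds)).add
      ((tendsto_const_nhds.mul (hfst.norm.add hsnd.norm)).mul
        (hsnd.sub tendsto_const_nhds).norm)
  have := le_of_tendsto_of_tendsto' hL hR hineq
  simpa using this

end KatoDomain

/-! ### The heat semigroup -/

/-- The function `μ ↦ λ exp (-t λ)`, where `λ = 1/μ - 1`, for `μ > 0`, extended by `0` to `μ ≤ 0`.
It expresses `L exp (-t L)` through the resolvent of `L`. -/
def genSymbol (t μ : ℝ) : ℝ := if 0 < μ then (1 / μ - 1) * Real.exp (-t * (1 / μ - 1)) else 0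

theorem continuous_genSymbol {t : ℝ} (ht : 0 < t) : Continuous (genSymbol t) := by
  have h : genSymbol t = fun μ => Real.exp t *
      ((Polynomial.C (1 / t) * Polynomial.X - 1).eval (μ / t)⁻¹ * expNegInvGlue (μ / t)) := by
    funext μ
    unfold genSymbol expNegInvGlue
    by_cases hμ : 0 < μ
    · have h1 : Real.exp (-t * (1 / μ - 1)) = Real.exp t * Real.exp (-(μ / t)⁻¹) := by
        rw [← Real.exp_add]
        congr 1
        field_simp
        ring
      rw [if_pos hμ, if_neg (not_le.2 (div_pos hμ ht)), h1]
      simp only [Polynomial.eval_sub, Polynomial.eval_mul, Polynomial.eval_C, Polynomial.eval_X,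
        Polynomial.eval_one]
      field_simp
    · rw [if_neg hμ, if_pos (div_nonpos_of_nonpos_of_nonneg (not_lt.1 hμ) ht.le), mul_zero,
        mul_zero]
  rw [h]
  exact continuous_const.mul
    ((expNegInvGlue.continuous_polynomial_eval_inv_mul _).comp (continuous_id.div_const t))

theorem mul_genSymbol_add_heatSymbol (t μ : ℝ) :
    μ * (genSymbol t μ + heatSymbol t μ) = heatSymbol t μ := by
  unfold genSymbol heatSymbol
  split_ifs with h
  · field_simp
    ring
  · simp

theorem abs_heatSymbol_taylor_le {s t μ : ℝ} (ht : 0 < t) (hs : |s - t| ≤ t / 2) (hμ : μ ≤ 1) :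
    |heatSymbol s μ - heatSymbol t μ + (s - t) * genSymbol t μ| ≤ 8 / t ^ 2 * (s - t) ^ 2 := by
  unfold genSymbol heatSymbol
  split_ifs with h
  · set l := 1 / μ - 1 with hl
    have hl0 : 0 ≤ l := by rw [hl, sub_nonneg, le_div_iff₀ h]; linarith
    have h1 : Real.exp (-s * l) - Real.exp (-t * l) + (s - t) * (l * Real.exp (-t * l))
        = Real.exp (-t * l) * (Real.exp (-(s - t) * l) - (1 + -(s - t) * l)) := by
      have : Real.exp (-s * l) = Real.exp (-t * l) * Real.exp (-(s - t) * l) := by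
        rw [← Real.exp_add]; ring_nf
      rw [this]; ring
    have h2 : |Real.exp (-(s - t) * l) - (1 + -(s - t) * l)|
        ≤ ((s - t) * l) ^ 2 * Real.exp (t / 2 * l) := by
      have h3 := Complex.norm_exp_sub_sum_le_norm_mul_exp ((-(s - t) * l : ℝ) : ℂ) 2
      have h4 : (Complex.exp ((-(s - t) * l : ℝ) : ℂ)
          - ∑ m ∈ Finset.range 2, ((-(s - t) * l : ℝ) : ℂ) ^ m / (m.factorial : ℂ))
          = ((Real.exp (-(s - t) * l) - (1 + -(s - t) * l) : ℝ) : ℂ) := by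
        simp [Finset.sum_range_succ]
      rw [h4, Complex.norm_real, Complex.norm_real, Real.norm_eq_abs, Real.norm_eq_abs,
        sq_abs] at h3
      refine h3.trans ?_
      rw [show (-(s - t) * l) ^ 2 = ((s - t) * l) ^ 2 by ring]
      gcongr
      rw [abs_mul, abs_neg, abs_of_nonneg hl0]
      gcongr
    -- from `z² / 2 ≤ exp z` with `z = t l / 2`
    have h5 : l ^ 2 ≤ 8 / t ^ 2 * Real.exp (t / 2 * l) := by
      have := Real.quadratic_le_exp_of_nonneg (show 0 ≤ t / 2 * l by positivity)
      rw [div_mul_eq_mul_div, le_div_iff₀ (by positivity)]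
      nlinarith [show 0 ≤ t / 2 * l by positivity]
    have h6 : Real.exp (-t * l) * (Real.exp (t / 2 * l) * Real.exp (t / 2 * l)) = 1 := by
      rw [← Real.exp_add, ← Real.exp_add, Real.exp_eq_one_iff]
      ring
    rw [h1, abs_mul, Real.abs_exp]
    calc _ ≤ Real.exp (-t * l) * (((s - t) * l) ^ 2 * Real.exp (t / 2 * l)) := by gcongr
      _ = (s - t) ^ 2 * Real.exp (-t * l) * Real.exp (t / 2 * l) * l ^ 2 := by ring
      _ ≤ (s - t) ^ 2 * Real.exp (-t * l) * Real.exp (t / 2 * l)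
          * (8 / t ^ 2 * Real.exp (t / 2 * l)) := by gcongr
      _ = 8 / t ^ 2 * (s - t) ^ 2 *
          (Real.exp (-t * l) * (Real.exp (t / 2 * l) * Real.exp (t / 2 * l))) := by ring
      _ = _ := by rw [h6, mul_one]
  · simp only [sub_zero, mul_zero, add_zero, abs_zero]
    positivity

theorem heatSymbol_nonneg (t μ : ℝ) : 0 ≤ heatSymbol t μ := by
  unfold heatSymbol
  split_ifs <;> positivity

theorem heatSymbol_le_one {t μ : ℝ} (ht : 0 < t) (hμ : μ ≤ 1) : heatSymbol t μ ≤ 1 := by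
  unfold heatSymbol
  split_ifs with h
  · have : 0 ≤ 1 / μ - 1 := by rw [sub_nonneg, le_div_iff₀ h]; linarith
    rw [Real.exp_le_one_iff]
    nlinarith
  · exact zero_le_one

theorem abs_heatSymbol_mul_sub_le {t μ : ℝ} (ht : 0 < t) (hμ0 : 0 ≤ μ) (hμ : μ ≤ 1) :
    |heatSymbol t μ * μ - μ| ≤ t := by
  rcases hμ0.eq_or_lt with h | h
  · simp [← h, ht.le]
  have h1 := heatSymbol_le_one ht hμ
  have h2 : 1 - heatSymbol t μ ≤ t * (1 / μ - 1) := by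
    rw [heatSymbol, if_pos h]
    have := Real.add_one_le_exp (-t * (1 / μ - 1))
    linarith
  have h3 : heatSymbol t μ * μ - μ = -((1 - heatSymbol t μ) * μ) := by ring
  rw [h3, abs_neg, abs_of_nonneg (mul_nonneg (by linarith) hμ0)]
  calc _ ≤ t * (1 / μ - 1) * μ := by gcongr
    _ = t * (1 - μ) := by field_simp
    _ ≤ t := by nlinarith

theorem hasFDerivAt_of_norm_sub_le_sq {E F : Type*} [NormedAddCommGroup E] [NormedSpace ℝ E]
    [NormedAddCommGroup F] [NormedSpace ℝ F] {f : E → F} {f' : E →L[ℝ] F} {x : E} {C : ℝ}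
    (h : ∀ᶠ y in 𝓝 x, ‖f y - f x - f' (y - x)‖ ≤ C * ‖y - x‖ ^ 2) : HasFDerivAt f f' x := by
  refine HasFDerivAt.of_isLittleO ((Asymptotics.IsBigO.of_bound C ?_).trans_isLittleO
    (Asymptotics.isLittleO_pow_sub_sub x one_lt_two))
  filter_upwards [h] with y hy
  simpa using hy

theorem hasDerivAt_of_norm_sub_le_sq {F : Type*} [NormedAddCommGroup F] [NormedSpace ℝ F]
    {f : ℝ → F} {f' : F} {x C : ℝ}
    (h : ∀ᶠ y in 𝓝 x, ‖f y - f x - (y - x) • f'‖ ≤ C * (y - x) ^ 2) : HasDerivAt f f' x := by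
  rw [hasDerivAt_iff_hasFDerivAt]
  refine hasFDerivAt_of_norm_sub_le_sq (C := C) ?_
  filter_upwards [h] with y hy
  simpa using hy

section Abstract

variable {H : Type*} [NormedAddCommGroup H] [InnerProductSpace ℂ H] [CompleteSpace H]
  {R : H →L[ℂ] H}

/-- The operator `L exp (-t L)`, for `t > 0`, of a nonnegative self-adjoint operator `L` with
resolvent `R = (1 + L)⁻¹`. -/
def genOfResolvent (R : H →L[ℂ] H) (t : ℝ) : H →L[ℂ] H := cfc (genSymbol t) R

theorem norm_heatOfResolvent_le (h1 : ∀ μ ∈ spectrum ℝ R, μ ≤ 1) {t : ℝ} (ht : 0 < t) :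
    ‖heatOfResolvent R t‖ ≤ 1 := by
  refine norm_cfc_le zero_le_one fun μ hμ => ?_
  rw [Real.norm_of_nonneg (heatSymbol_nonneg t μ)]
  exact heatSymbol_le_one ht (h1 μ hμ)

/-- The semigroup solves `d/dt exp (-t L) = -L exp (-t L)`. -/
theorem hasDerivAt_heatOfResolvent (h1 : ∀ μ ∈ spectrum ℝ R, μ ≤ 1)
    {t : ℝ} (ht : 0 < t) :
    HasDerivAt (heatOfResolvent R) (-genOfResolvent R t) t := by
  refine hasDerivAt_of_norm_sub_le_sq (C := 8 / t ^ 2) ?_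
  have hev : ∀ᶠ s in 𝓝 t, |s - t| ≤ t / 2 :=
    (Metric.closedBall_mem_nhds t (half_pos ht))
  filter_upwards [hev] with s hs
  have hs0 : 0 < s := by have := (abs_le.1 hs).1; linarith
  have hcs := (continuous_heatSymbol hs0).continuousOn (s := spectrum ℝ R)
  have hct := (continuous_heatSymbol ht).continuousOn (s := spectrum ℝ R)
  have hcg := (continuous_genSymbol ht).continuousOn (s := spectrum ℝ R)
  have h2 : heatOfResolvent R s - heatOfResolvent R t - (s - t) • -genOfResolvent R t
      = cfc (fun μ => heatSymbol s μ - heatSymbol t μ + (s - t) * genSymbol t μ) R := by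
    rw [cfc_add R (fun μ => heatSymbol s μ - heatSymbol t μ) (fun μ => (s - t) * genSymbol t μ)
      (hcs.sub hct) (continuousOn_const.mul hcg), cfc_sub (heatSymbol s) (heatSymbol t) R hcs hct,
      cfc_const_mul (s - t) (genSymbol t) R hcg, smul_neg, sub_neg_eq_add]
    rfl
  rw [h2]
  exact norm_cfc_le (by positivity) fun μ hμ => abs_heatSymbol_taylor_le ht hs (h1 μ hμ)

/-- The identity `(1 + L)⁻¹ (L exp (-t L) + exp (-t L)) = exp (-t L)`. -/
theorem mul_genOfResolvent_add (hR : IsSelfAdjoint R) {t : ℝ} (ht : 0 < t) :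
    R * (genOfResolvent R t + heatOfResolvent R t) = heatOfResolvent R t := by
  have hct := (continuous_heatSymbol ht).continuousOn (s := spectrum ℝ R)
  have hcg := (continuous_genSymbol ht).continuousOn (s := spectrum ℝ R)
  rw [heatOfResolvent, genOfResolvent, ← cfc_add R (genSymbol t) (heatSymbol t) hcg hct]
  nth_rewrite 1 [← cfc_id' ℝ R]
  rw [← cfc_mul (fun μ => μ) (fun μ => genSymbol t μ + heatSymbol t μ) R continuousOn_id
    (hcg.add hct)]
  congr 1
  funext μ
  exact mul_genSymbol_add_heatSymbol t μ

theorem norm_heatOfResolvent_mul_sub_le (hR : IsSelfAdjoint R)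
    (h0 : ∀ μ ∈ spectrum ℝ R, 0 ≤ μ) (h1 : ∀ μ ∈ spectrum ℝ R, μ ≤ 1) {t : ℝ} (ht : 0 < t) :
    ‖heatOfResolvent R t * R - R‖ ≤ t := by
  have hct := (continuous_heatSymbol ht).continuousOn (s := spectrum ℝ R)
  have h : heatOfResolvent R t * R - R = cfc (fun μ => heatSymbol t μ * μ - μ) R := by
    rw [cfc_sub (fun μ => heatSymbol t μ * μ) (fun μ => μ) R (hct.mul continuousOn_id)
      continuousOn_id, cfc_mul (heatSymbol t) (fun μ => μ) R hct continuousOn_id, cfc_id' ℝ R]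
    rfl
  rw [h]
  exact norm_cfc_le ht.le fun μ hμ => abs_heatSymbol_mul_sub_le ht (h0 μ hμ) (h1 μ hμ)

/-- Strong continuity at `0`. It holds in norm on the range of the resolvent, which is dense. -/
theorem tendsto_heatOfResolvent_apply (hR : IsSelfAdjoint R)
    (h0 : ∀ μ ∈ spectrum ℝ R, 0 ≤ μ) (h1 : ∀ μ ∈ spectrum ℝ R, μ ≤ 1) (hd : DenseRange R) (f : H) :
    Tendsto (fun t => heatOfResolvent R t f) (𝓝[>] 0) (𝓝 f) := by
  rw [Metric.tendsto_nhds]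
  intro δ hδ
  obtain ⟨g, hg⟩ := hd.exists_dist_lt f (show 0 < δ / 3 by positivity)
  rw [dist_eq_norm] at hg
  have h2 : Tendsto (fun t : ℝ => t * ‖g‖) (𝓝[>] 0) (𝓝 0) := by
    have : Tendsto (fun t : ℝ => t * ‖g‖) (𝓝 0) (𝓝 (0 * ‖g‖)) := by
      exact (continuous_id.mul continuous_const).tendsto 0
    rw [zero_mul] at this
    exact this.mono_left nhdsWithin_le_nhds
  filter_upwards [h2.eventually_lt_const (show 0 < δ / 3 by positivity), self_mem_nhdsWithin]
    with t ht1 ht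
  have ht0 : 0 < t := ht
  set P := heatOfResolvent R t with hP
  have e1 : P f - f = P (f - R g) + (P * R - R) g - (f - R g) := by
    simp only [map_sub, _root_.sub_apply, mul_apply_eq_comp]
    abel
  have e2 : ‖P (f - R g)‖ ≤ ‖f - R g‖ := by
    simpa using P.le_of_opNorm_le (norm_heatOfResolvent_le h1 ht0) (f - R g)
  have e3 : ‖(P * R - R) g‖ ≤ t * ‖g‖ :=
    (P * R - R).le_of_opNorm_le (norm_heatOfResolvent_mul_sub_le hR h0 h1 ht0) g
  rw [dist_eq_norm, e1]
  calc _ ≤ ‖P (f - R g)‖ + ‖(P * R - R) g‖ + ‖f - R g‖ :=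
        (norm_sub_le _ _).trans (by gcongr; exact norm_add_le _ _)
    _ < δ := by linarith

end Abstract

theorem volume_compl_regularSet : volume regularSetᶜ = 0 := by
  refine measure_mono_null (t := ((LinearMap.ker
    (EuclideanSpace.proj 0 : R4 →L[ℝ] ℝ).toLinearMap : Submodule ℝ R4) :
      Set R4)) (fun x hx => ?_) (Measure.addHaar_submodule _ _ fun h => ?_)
  · simp only [regularSet, Set.mem_compl_iff, Set.mem_ofPred_eq, not_or, not_not] at hx
    exact hx.1
  · have h1 : EuclideanSpace.single (0 : Fin 4) (1 : ℝ) ∈ (⊤ : Submodule ℝ R4) := trivial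
    rw [← h] at h1
    have : (EuclideanSpace.single (0 : Fin 4) (1 : ℝ)) 0 = 0 := h1
    simp at this

theorem isOpen_regularSet : IsOpen regularSet :=
  (isOpen_ne_fun (by fun_prop) continuous_const).union
    (isOpen_ne_fun (by fun_prop) continuous_const)

/-- Test functions are dense in `L²`, since the singular plane is a null set. -/
theorem eq_zero_of_forall_isTest {f : L2}
    (h : ∀ (φ : R4 → ℂ) (hφ : IsTest φ), ⟪hφ.memLp.toLp, f⟫_ℂ = 0) : f = 0 := by
  have hae := isOpen_regularSet.ae_eq_zero_of_integral_contDiff_smul_eq_zero (f := f)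
    (μ := (volume : Measure R4))
    (((Lp.memLp f).locallyIntegrable (by norm_num)).locallyIntegrableOn _)
    fun g hg hgc hgs => by
      have hφ : IsTest fun x => (g x : ℂ) :=
        ⟨Complex.ofRealCLM.contDiff.comp hg, hgc.comp_left (g := fun r : ℝ => (r : ℂ)) (by simp),
          (closure_mono fun x hx => by
            contrapose! hx
            simp [Function.notMem_support.1 hx]).trans hgs⟩
      rw [← h _ hφ, L2.inner_def]
      refine integral_congr_ae ?_
      filter_upwards [hφ.memLp.coeFn_toLp] with x hx
      rw [hx, RCLike.inner_apply, Complex.conj_ofReal, Complex.real_smul, mul_comm]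
  refine (Lp.eq_zero_iff_ae_eq_zero).2 ?_
  have h0 : ∀ᵐ x : R4, x ∈ regularSet := by
    rw [ae_iff]; exact volume_compl_regularSet
  filter_upwards [hae, h0] with x h1 h2
  exact h1 h2

theorem norm_resolvent_le (α : ℝ) : ‖resolvent α‖ ≤ 1 := by
  refine ContinuousLinearMap.opNorm_le_bound _ zero_le_one fun f => ?_
  rw [resolvent_apply, one_mul]
  refine (WithLp.norm_fst_le L2 _).trans ?_
  refine ((formGraph α).norm_starProjection_apply_le _).trans ?_
  simp

theorem isPositive_resolvent (α : ℝ) : (resolvent α).IsPositive := by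
  rw [ContinuousLinearMap.isPositive_def]
  refine ⟨(ContinuousLinearMap.isSelfAdjoint_iff_isSymmetric.1 (isSelfAdjoint_resolvent α)),
    fun f => ?_⟩
  have h := (formGraph α).re_inner_starProjection_nonneg (WithLp.toLp 2 (f, (0 : L2Vec)))
  rw [WithLp.prod_inner_apply] at h
  change 0 ≤ (⟪resolvent α f, f⟫_ℂ + ⟪_, (0 : L2Vec)⟫_ℂ).re at h
  rw [inner_zero_right, add_zero] at h
  exact h

theorem spectrum_resolvent_nonneg (α : ℝ) : ∀ μ ∈ spectrum ℝ (resolvent α), 0 ≤ μ := fun _ hμ =>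
  spectrum_nonneg_of_nonneg ((ContinuousLinearMap.nonneg_iff_isPositive _).2
    (isPositive_resolvent α)) hμ

theorem spectrum_resolvent_le_one (α : ℝ) : ∀ μ ∈ spectrum ℝ (resolvent α), μ ≤ 1 := fun μ hμ => by
  have h := spectrum.subset_closedBall_norm_mul (resolvent α) hμ
  rw [mem_closedBall_zero_iff, Real.norm_eq_abs] at h
  have h1 : ‖(1 : L2 →L[ℂ] L2)‖ ≤ 1 := ContinuousLinearMap.norm_id_le
  have := mul_le_mul (norm_resolvent_le α) h1 (norm_nonneg _) zero_le_one
  exact (le_abs_self μ).trans (by linarith)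

theorem denseRange_resolvent (α : ℝ) : DenseRange (resolvent α) := by
  have hker : ∀ f, resolvent α f = 0 → f = 0 := by
    intro f hf
    obtain ⟨U, hU, h⟩ := (resolvent_eq_iff α f 0).1 hf
    -- `(0, U)` is itself in the form graph, hence `⟪U, U⟫ = ⟪0, f⟫ = 0`
    have hU0 : U = 0 := by
      have := h _ hU
      simpa using this
    refine eq_zero_of_forall_isTest fun φ hφ => ?_
    have := h (WithLp.toLp 2 (hφ.memLp.toLp, (hφ.memLp_magGrad α).toLp))
      ((gradGraph α).le_topologicalClosure
        ⟨φ, hφ, hφ.memLp.coeFn_toLp, (hφ.memLp_magGrad α).coeFn_toLp⟩)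
    rw [hU0, inner_zero_right, sub_zero] at this
    exact this.symm
  have h1 : (resolvent α).range.topologicalClosure = ⊤ := by
    rw [Submodule.topologicalClosure_eq_top_iff, ContinuousLinearMap.orthogonal_range,
      (isSelfAdjoint_resolvent α).adjoint_eq, LinearMap.ker_eq_bot']
    exact hker
  exact Submodule.dense_iff_topologicalClosure_eq_top.2 h1

theorem tendsto_heatOp_apply (α : ℝ) (f : L2) :
    Tendsto (fun t => heatOp α t f) (𝓝[>] 0) (𝓝 f) :=
  tendsto_heatOfResolvent_apply (isSelfAdjoint_resolvent α) (spectrum_resolvent_nonneg α)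
    (spectrum_resolvent_le_one α) (denseRange_resolvent α) f

/-- The function `t ↦ exp (-t L_A) f` solves the heat equation of `L_A`. -/
theorem exists_hasDerivAt_heatOp (α : ℝ) (f : L2) {t : ℝ} (ht : 0 < t) :
    ∃ w : L2, IsLA α (heatOp α t f) w ∧ HasDerivAt (fun s => heatOp α s f) (-w) t := by
  refine ⟨genOfResolvent (resolvent α) t f, ?_, ?_⟩
  · have h := DFunLike.congr_fun (mul_genOfResolvent_add (isSelfAdjoint_resolvent α) ht) f
    have h1 : IsLA α (heatOp α t f)
        (genOfResolvent (resolvent α) t f + heatOp α t f - heatOp α t f) :=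
      (resolvent_eq_iff α _ _).1 h
    rwa [add_sub_cancel_right] at h1
  · have h := hasDerivAt_heatOfResolvent (spectrum_resolvent_le_one α) ht
    exact ((ContinuousLinearMap.apply ℂ L2 f).restrictScalars ℝ).hasFDerivAt.comp_hasDerivAt t h

/-! ### The Gaussian -/

/-- The heat kernel of `ℝ⁴` at time `a`, without its normalising factor `(4 π)⁻²`. -/
def gauss (a : ℝ) (z : R4) : ℝ := (a ^ 2)⁻¹ * Real.exp (-‖z‖ ^ 2 / (4 * a))

/-- The time derivative of `gauss a z`. -/
def dgauss (a : ℝ) (z : R4) : ℝ := (‖z‖ ^ 2 / (4 * a ^ 2) - 2 / a) * gauss a z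

theorem gauss_nonneg (a : ℝ) (z : R4) : 0 ≤ gauss a z := by unfold gauss; positivity

theorem continuous_gauss (a : ℝ) : Continuous (gauss a) := by unfold gauss; fun_prop

theorem continuous_dgauss (a : ℝ) : Continuous (dgauss a) := by
  unfold dgauss; exact (by fun_prop : Continuous _).mul (continuous_gauss a)

theorem hasDerivAt_gauss {a : ℝ} (ha : a ≠ 0) (z : R4) :
    HasDerivAt (fun b => gauss b z) (dgauss a z) a := by
  have h1 : HasDerivAt (fun b : ℝ => (b ^ 2)⁻¹) _ a := (hasDerivAt_pow 2 a).fun_inv (by positivity)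
  have h2 : HasDerivAt (fun b : ℝ => -‖z‖ ^ 2 / (4 * b)) _ a :=
    (hasDerivAt_const a (-‖z‖ ^ 2)).fun_div ((hasDerivAt_id a).const_mul 4) (by simpa using ha)
  have h3 : HasDerivAt (fun b => gauss b z) _ a := h1.fun_mul h2.exp
  refine h3.congr_deriv ?_
  simp only [dgauss, gauss]
  field_simp
  ring

theorem gauss_le_of_abs_sub_le {a b : ℝ} (ha : 0 < a) (hb : |b - a| ≤ a / 2) (z : R4) :
    gauss b z ≤ 4 / a ^ 2 * Real.exp (-‖z‖ ^ 2 / (8 * a)) := by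
  obtain ⟨h1, h2⟩ := abs_le.1 hb
  have hb0 : a / 2 ≤ b := by linarith
  have hbp : 0 < b := by linarith
  have h3 : (b ^ 2)⁻¹ ≤ 4 / a ^ 2 := by
    rw [show 4 / a ^ 2 = ((a / 2) ^ 2)⁻¹ by field_simp; norm_num]
    gcongr
  unfold gauss
  have h4 : -‖z‖ ^ 2 / (4 * b) ≤ -‖z‖ ^ 2 / (8 * a) := by
    rw [neg_div, neg_div, neg_le_neg_iff]
    exact div_le_div_of_nonneg_left (by positivity) (by positivity) (by linarith)
  gcongr

/-- A bound on the time derivative of the Gaussian, locally uniform in time: half of the exponent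
`‖z‖² / (8 a)` absorbs the quadratic factor. -/
theorem abs_dgauss_le {a b : ℝ} (ha : 0 < a) (hb : |b - a| ≤ a / 2) (z : R4) :
    |dgauss b z| ≤ 80 / a ^ 3 * Real.exp (-(1 / (16 * a)) * ‖z‖ ^ 2) := by
  obtain ⟨h1, h2⟩ := abs_le.1 hb
  have hb0 : a / 2 ≤ b := by linarith
  have hbp : 0 < b := by linarith
  set e := Real.exp (-(1 / (16 * a)) * ‖z‖ ^ 2) with he
  have he0 : 0 < e := Real.exp_pos _
  have h3 : Real.exp (-‖z‖ ^ 2 / (8 * a)) = e * e := by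
    rw [he, ← Real.exp_add]; congr 1; field_simp; ring
  have h4 : ‖z‖ ^ 2 * e ≤ 16 * a := by
    have h5 := Real.add_one_le_exp (1 / (16 * a) * ‖z‖ ^ 2)
    have h6 : e * Real.exp (1 / (16 * a) * ‖z‖ ^ 2) = 1 := by
      rw [he, ← Real.exp_add, Real.exp_eq_one_iff]; ring
    have h7 : 1 / (16 * a) * ‖z‖ ^ 2 * e ≤ 1 := by nlinarith
    have h8 : 1 / (16 * a) * ‖z‖ ^ 2 * e = ‖z‖ ^ 2 * e / (16 * a) := by ring
    rwa [h8, div_le_one (by positivity)] at h7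
  have he1 : e ≤ 1 := by
    rw [he, Real.exp_le_one_iff]
    have : 0 ≤ 1 / (16 * a) * ‖z‖ ^ 2 := by positivity
    linarith
  have h5 : |‖z‖ ^ 2 / (4 * b ^ 2) - 2 / b| ≤ ‖z‖ ^ 2 / a ^ 2 + 4 / a := by
    refine (abs_sub _ _).trans ?_
    rw [abs_of_nonneg (by positivity), abs_of_nonneg (by positivity)]
    have h6 : 2 / b ≤ 4 / a := by rw [div_le_div_iff₀ hbp ha]; linarith
    have h7 : ‖z‖ ^ 2 / (4 * b ^ 2) ≤ ‖z‖ ^ 2 / a ^ 2 := by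
      gcongr
      nlinarith
    exact add_le_add h7 h6
  rw [dgauss, abs_mul, abs_of_nonneg (gauss_nonneg b z)]
  calc _ ≤ (‖z‖ ^ 2 / a ^ 2 + 4 / a) * (4 / a ^ 2 * (e * e)) := by
        rw [← h3]
        exact mul_le_mul h5 (gauss_le_of_abs_sub_le ha hb z) (gauss_nonneg b z) (by positivity)
    _ = (‖z‖ ^ 2 * e / a ^ 2 + 4 / a * e) * (4 / a ^ 2) * e := by ring
    _ ≤ (16 * a / a ^ 2 + 4 / a * 1) * (4 / a ^ 2) * e := by gcongr
    _ = _ := by field_simp; ring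

theorem integrable_exp_neg_mul_norm_sq {b : ℝ} (hb : 0 < b) :
    Integrable fun z : R4 => Real.exp (-b * ‖z‖ ^ 2) := by
  have h := (GaussianFourier.integrable_cexp_neg_mul_sq_norm_add (V := R4) (b := (b : ℂ))
    (by simpa using hb) 0 0).norm
  refine h.congr (ae_of_all _ fun z => ?_)
  simp only [Complex.norm_exp]
  congr 1
  norm_cast
  simp

theorem memLp_exp_neg_mul_norm_sq {b : ℝ} (hb : 0 < b) (y : R4) :
    MemLp (fun x : R4 => Real.exp (-b * ‖x - y‖ ^ 2)) 2 (volume : Measure R4) := by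
  rw [memLp_two_iff_integrable_sq (by fun_prop)]
  refine ((integrable_exp_neg_mul_norm_sq (show 0 < 2 * b by positivity)).comp_sub_right y).congr
    (ae_of_all _ fun x => ?_)
  simp only
  rw [← Real.exp_nat_mul]
  congr 1
  push_cast
  ring

theorem integrable_gauss {a : ℝ} (ha : 0 < a) (y : R4) : Integrable fun x => gauss a (x - y) := by
  refine (((integrable_exp_neg_mul_norm_sq (show 0 < 1 / (4 * a) by positivity)).comp_sub_right
    y).const_mul (a ^ 2)⁻¹).congr (ae_of_all _ fun x => ?_)
  simp only [gauss]
  ring_nf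

theorem memLp_gauss {a : ℝ} (ha : 0 < a) (y : R4) :
    MemLp (fun x => gauss a (x - y)) 2 (volume : Measure R4) := by
  refine ((memLp_exp_neg_mul_norm_sq (show 0 < 1 / (4 * a) by positivity) y).const_mul
    (a ^ 2)⁻¹).ae_eq (ae_of_all _ fun x => ?_)
  simp only [gauss]
  ring_nf

theorem memLp_dgauss {a : ℝ} (ha : 0 < a) (y : R4) :
    MemLp (fun x => dgauss a (x - y)) 2 (volume : Measure R4) := by
  refine (memLp_exp_neg_mul_norm_sq (show 0 < 1 / (16 * a) by positivity) y).of_le_mul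
    (c := 80 / a ^ 3)
    ((continuous_dgauss a).comp (continuous_id.sub continuous_const)).aestronglyMeasurable
    (ae_of_all _ fun x => ?_)
  rw [Real.norm_eq_abs, Real.norm_eq_abs, Real.abs_exp]
  exact abs_dgauss_le ha (by rw [sub_self, abs_zero]; positivity) (x - y)

theorem contDiff_gauss_sub (a : ℝ) (y : R4) : ContDiff ℝ ∞ fun x => gauss a (x - y) := by
  unfold gauss
  exact contDiff_const.mul ((((contDiff_id.sub contDiff_const).norm_sq ℝ).neg.div_const _).exp)

theorem hasFDerivAt_gauss_sub (a : ℝ) (x y : R4) :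
    HasFDerivAt (fun x => gauss a (x - y)) ((-(1 / (2 * a)) * gauss a (x - y)) • innerSL ℝ (x - y))
      x := by
  have h1 : HasFDerivAt (fun x : R4 => -‖x - y‖ ^ 2 / (4 * a)) _ x :=
    ((((hasFDerivAt_id x).sub_const y).norm_sq).fun_neg.mul_const (4 * a)⁻¹)
  have h2 := h1.exp.const_mul (a ^ 2)⁻¹
  refine h2.congr_fderiv ?_
  ext v
  simp [gauss]
  ring

theorem fderiv_gauss_sub (a : ℝ) (x y : R4) (j : Fin 4) :
    fderiv ℝ (fun x => gauss a (x - y)) x (EuclideanSpace.single j 1)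
      = -(1 / (2 * a)) * (gauss a (x - y) * (x j - y j)) := by
  rw [(hasFDerivAt_gauss_sub a x y).fderiv]
  simp [EuclideanSpace.inner_single_right]
  ring

/-- The Gaussian solves the heat equation. -/
theorem lapl_gauss_sub {a : ℝ} (ha : a ≠ 0) (y x : R4) :
    lapl (fun x => gauss a (x - y)) x = dgauss a (x - y) := by
  have h1 : ∀ j, fderiv ℝ (fun z => fderiv ℝ (fun x => gauss a (x - y)) z
      (EuclideanSpace.single j 1)) x (EuclideanSpace.single j 1)
      = -(1 / (2 * a)) * gauss a (x - y)
        + 1 / (4 * a ^ 2) * gauss a (x - y) * (x j - y j) ^ 2 := by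
    intro j
    simp_rw [fderiv_gauss_sub]
    have h2 : HasFDerivAt (fun z : R4 => z j - y j) (EuclideanSpace.proj j : R4 →L[ℝ] ℝ) x :=
      (EuclideanSpace.proj j : R4 →L[ℝ] ℝ).hasFDerivAt.sub_const _
    have h3 := ((hasFDerivAt_gauss_sub a x y).fun_mul h2).const_mul (-(1 / (2 * a)))
    rw [h3.fderiv]
    simp [EuclideanSpace.inner_single_right]
    field_simp
    ring
  rw [lapl, Finset.sum_congr rfl fun j _ => h1 j, Finset.sum_add_distrib, ← Finset.mul_sum,
    dgauss, EuclideanSpace.norm_sq_eq]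
  simp [Fin.sum_univ_four]
  field_simp
  ring

theorem isWeight_gauss {a : ℝ} (ha : 0 < a) (y : R4) :
    ∃ M, IsWeight (fun x => gauss a (x - y)) M := by
  have hle : ∀ z, gauss a z ≤ (a ^ 2)⁻¹ := fun z => by
    have : Real.exp (-‖z‖ ^ 2 / (4 * a)) ≤ 1 := by
      rw [Real.exp_le_one_iff, neg_div, neg_nonpos]; positivity
    exact (mul_le_mul_of_nonneg_left this (by positivity)).trans_eq (mul_one _)
  refine ⟨(a ^ 2)⁻¹ * (1 + 1 / (4 * a)), contDiff_gauss_sub a y, fun x => gauss_nonneg _ _,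
    fun x => (hle _).trans ?_, fun x j => ?_, ?_⟩
  · have : 0 ≤ (a ^ 2)⁻¹ * (1 / (4 * a)) := by positivity
    linarith
  · rw [fderiv_gauss_sub, abs_mul, abs_mul, abs_of_nonneg (gauss_nonneg _ _), abs_neg,
      abs_of_pos (by positivity : 0 < 1 / (2 * a))]
    have h1 : |x j - y j| ≤ ‖x - y‖ := by
      simpa using PiLp.norm_apply_le (x - y) j
    set r := ‖x - y‖ with hr
    have h2 : r ≤ (1 + r ^ 2) / 2 := by nlinarith [sq_nonneg (r - 1)]
    have h3 : r ^ 2 / (4 * a) * Real.exp (-r ^ 2 / (4 * a)) ≤ 1 := by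
      have h5 := Real.add_one_le_exp (r ^ 2 / (4 * a))
      have h6 : Real.exp (r ^ 2 / (4 * a)) * Real.exp (-r ^ 2 / (4 * a)) = 1 := by
        rw [← Real.exp_add, Real.exp_eq_one_iff]; ring
      nlinarith [Real.exp_pos (-r ^ 2 / (4 * a))]
    have h4 : Real.exp (-r ^ 2 / (4 * a)) ≤ 1 := by
      rw [Real.exp_le_one_iff, neg_div, neg_nonpos]; positivity
    calc 1 / (2 * a) * (gauss a (x - y) * |x j - y j|)
        ≤ 1 / (2 * a) * (gauss a (x - y) * ((1 + r ^ 2) / 2)) := by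
          have := gauss_nonneg a (x - y)
          gcongr
          exact h1.trans h2
      _ = (a ^ 2)⁻¹ * (1 / (4 * a) * Real.exp (-r ^ 2 / (4 * a))
          + r ^ 2 / (4 * a) * Real.exp (-r ^ 2 / (4 * a))) := by
          rw [gauss, ← hr]; ring
      _ ≤ (a ^ 2)⁻¹ * (1 / (4 * a) * 1 + 1) := by gcongr
      _ = _ := by ring
  · refine (memLp_dgauss ha y).ae_eq (ae_of_all _ fun x => ?_)
    exact (lapl_gauss_sub ha.ne' y x).symm

/-- The function `x ↦ gauss a (x - y)` as an element of `L²`, for `a > 0`. For `a ≤ 0`, where it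
need not be square integrable, the value is `0`. -/
def gaussLp (y : R4) (a : ℝ) : Lp ℝ 2 (volume : Measure R4) :=
  if h : 0 < a then (memLp_gauss h y).toLp else 0

theorem gaussLp_of_pos {a : ℝ} (ha : 0 < a) (y : R4) : gaussLp y a = (memLp_gauss ha y).toLp :=
  dif_pos ha

theorem coeFn_gaussLp {a : ℝ} (ha : 0 < a) (y : R4) :
    gaussLp y a =ᵐ[volume] fun x => gauss a (x - y) := by
  rw [gaussLp_of_pos ha]; exact MemLp.coeFn_toLp _

theorem inner_gaussLp {a : ℝ} (ha : 0 < a) (y : R4) (h : Lp ℝ 2 (volume : Measure R4)) :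
    ⟪gaussLp y a, h⟫_ℝ = ∫ x, gauss a (x - y) * h x := by
  rw [L2.inner_def]
  refine integral_congr_ae ?_
  filter_upwards [coeFn_gaussLp ha y] with x hx
  rw [hx, RCLike.inner_apply, mul_comm]
  rfl

/-- The Gaussian is locally Lipschitz in time, with values in `L²`. -/
theorem exists_norm_gaussLp_sub_le {a : ℝ} (ha : 0 < a) (y : R4) :
    ∃ C, ∀ b, |b - a| ≤ a / 2 → ‖gaussLp y b - gaussLp y a‖ ≤ C * |b - a| := by
  set e := (memLp_exp_neg_mul_norm_sq (show 0 < 1 / (16 * a) by positivity) y).toLp with he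
  refine ⟨80 / a ^ 3 * ‖e‖, fun b hb => ?_⟩
  have hb0 : 0 < b := by have := (abs_le.1 hb).1; linarith
  rw [mul_right_comm]
  refine Lp.norm_le_mul_norm_of_ae_le_mul ?_
  filter_upwards [coeFn_gaussLp ha y, coeFn_gaussLp hb0 y, Lp.coeFn_sub (gaussLp y b) (gaussLp y a),
    (memLp_exp_neg_mul_norm_sq (show 0 < 1 / (16 * a) by positivity) y).coeFn_toLp]
    with x h1 h2 h3 h4
  rw [h3, Pi.sub_apply, h1, h2, he, h4, Real.norm_of_nonneg (Real.exp_pos _).le, mul_right_comm]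
  refine Convex.norm_image_sub_le_of_norm_hasDerivWithin_le (f := fun b => gauss b (x - y))
    (f' := fun b => dgauss b (x - y)) (s := Metric.closedBall a (a / 2)) (fun c hc => ?_)
    (fun c hc => ?_) (convex_closedBall _ _) (Metric.mem_closedBall_self (by positivity)) hb
  · have hc' : |c - a| ≤ a / 2 := hc
    have hc0 : 0 < c := by have := (abs_le.1 hc').1; linarith
    exact (hasDerivAt_gauss hc0.ne' _).hasDerivWithinAt
  · exact abs_dgauss_le ha hc _

theorem continuousAt_gaussLp {a : ℝ} (ha : 0 < a) (y : R4) : ContinuousAt (gaussLp y) a := by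
  obtain ⟨C, hC⟩ := exists_norm_gaussLp_sub_le ha y
  rw [ContinuousAt, tendsto_iff_norm_sub_tendsto_zero]
  have h1 : Tendsto (fun b => C * |b - a|) (𝓝 a) (𝓝 0) := by
    have : Continuous fun b => C * |b - a| := by fun_prop
    simpa using this.tendsto a
  refine squeeze_zero' (Eventually.of_forall fun b => norm_nonneg _) ?_ h1
  filter_upwards [Metric.closedBall_mem_nhds a (half_pos ha)] with b hb
  exact hC b hb

theorem hasDerivAt_inner_gaussLp {a : ℝ} (ha : 0 < a) (y : R4)
    (h : Lp ℝ 2 (volume : Measure R4)) :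
    HasDerivAt (fun b => ⟪gaussLp y b, h⟫_ℝ) (∫ x, dgauss a (x - y) * h x) a := by
  have hnhds : Metric.closedBall a (a / 2) ∈ 𝓝 a := Metric.closedBall_mem_nhds a (half_pos ha)
  have hpos : ∀ b ∈ Metric.closedBall a (a / 2), 0 < b := fun b hb => by
    have hb' : |b - a| ≤ a / 2 := hb
    have := (abs_le.1 hb').1; linarith
  have hbd := MemLp.integrable_mul
    ((memLp_exp_neg_mul_norm_sq (show 0 < 1 / (16 * a) by positivity) y).const_mul (80 / a ^ 3))
    (Lp.memLp h).norm
  have hd := (hasDerivAt_integral_of_dominated_loc_of_deriv_le (μ := (volume : Measure R4))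
    (F := fun b x => gauss b (x - y) * h x) (F' := fun b x => dgauss b (x - y) * h x) hnhds
    (Eventually.of_forall fun b => (((continuous_gauss b).comp
      (continuous_id.sub continuous_const)).aestronglyMeasurable.mul (Lp.memLp h).1))
    (MemLp.integrable_mul (memLp_gauss ha y) (Lp.memLp h))
    ((memLp_dgauss ha y).1.mul (Lp.memLp h).1)
    (ae_of_all _ fun x b hb => ?_) hbd
    (ae_of_all _ fun x b hb => (hasDerivAt_gauss (hpos b hb).ne' _).mul_const _)).2
  · refine hd.congr_of_eventuallyEq ?_
    filter_upwards [hnhds] with b hb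
    exact inner_gaussLp (hpos b hb) y h
  · rw [norm_mul]
    exact mul_le_mul_of_nonneg_right (abs_dgauss_le ha hb _) (norm_nonneg _)

/-! ### The diamagnetic inequality -/

section Comparison

variable {α ε M : ℝ} {ψ : R4 → ℝ}

theorem integral_norm_sq_eq (u : L2) : ∫ x, ‖u x‖ ^ 2 = ‖u‖ ^ 2 := by
  have h := inner_self_eq_norm_sq_to_K (𝕜 := ℂ) u
  rw [L2.inner_def] at h
  have h2 : ∫ x, ⟪u x, u x⟫_ℂ = ((∫ x, ‖u x‖ ^ 2 : ℝ) : ℂ) := by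
    rw [← integral_complex_ofReal]
    refine integral_congr_ae (ae_of_all _ fun x => ?_)
    simp only [inner_self_eq_norm_sq_to_K]
    push_cast
    rfl
  rw [h2] at h
  have h3 : ((∫ x, ‖u x‖ ^ 2 : ℝ) : ℂ) = ((‖u‖ ^ 2 : ℝ) : ℂ) := by push_cast; exact h
  exact_mod_cast h3

/-- The functional `u ↦ ∫ ψ (√(|u|² + ε²) - ε)` is differentiable on `L²`. -/
theorem hasFDerivAt_inner_smoothAbsLp (hψ : IsWeight ψ M) (hψ2 : MemLp ψ 2 (volume : Measure R4))
    (hε : 0 < ε) (u : L2) :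
    HasFDerivAt (fun v => ⟪hψ2.toLp, smoothAbsLp ε hε.le v⟫_ℝ)
      (Complex.reCLM ∘L (innerSL ℂ ((hψ.memLp_smul (smoothSignLp ε hε u)).toLp)).restrictScalars ℝ)
      u := by
  refine hasFDerivAt_of_norm_sub_le_sq (C := M / ε) (Eventually.of_forall fun v => ?_)
  set G := (hψ.memLp_smul (smoothSignLp ε hε u)).toLp with hG
  set g := hψ2.toLp with hg
  have h1 : (Complex.reCLM ∘L (innerSL ℂ G).restrictScalars ℝ) (v - u) = (⟪G, v - u⟫_ℂ).re := rfl
  have h2 : ⟪g, smoothAbsLp ε hε.le v⟫_ℝ - ⟪g, smoothAbsLp ε hε.le u⟫_ℝ - (⟪G, v - u⟫_ℂ).re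
      = ∫ x, (⟪g x, smoothAbsLp ε hε.le v x⟫_ℝ - ⟪g x, smoothAbsLp ε hε.le u x⟫_ℝ
        - (⟪G x, (v - u) x⟫_ℂ).re) := by
    have hi : Integrable fun x => (⟪G x, (v - u) x⟫_ℂ).re :=
      (L2.integrable_inner (𝕜 := ℂ) G (v - u)).re
    have hr : (⟪G, v - u⟫_ℂ).re = ∫ x, (⟪G x, (v - u) x⟫_ℂ).re := by
      rw [L2.inner_def, ← RCLike.re_eq_complex_re, ← integral_re (L2.integrable_inner _ _)]
    have hi2 : Integrable fun x =>
        ⟪g x, smoothAbsLp ε hε.le v x⟫_ℝ - ⟪g x, smoothAbsLp ε hε.le u x⟫_ℝ :=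
      (L2.integrable_inner _ _).sub (L2.integrable_inner _ _)
    rw [integral_sub hi2 hi,
      integral_sub (L2.integrable_inner _ _) (L2.integrable_inner _ _), hr]
    rfl
  rw [h1, h2]
  have hM : 0 ≤ M := (hψ.nonneg 0).trans (hψ.le 0)
  have hsq : Integrable fun x => ‖(v - u) x‖ ^ 2 :=
    (memLp_two_iff_integrable_sq_norm (Lp.memLp (v - u)).1).1 (Lp.memLp (v - u))
  rw [← integral_norm_sq_eq, ← integral_const_mul]
  refine norm_integral_le_of_norm_le (hsq.const_mul _) ?_
  filter_upwards [coeFn_smoothAbsLp hε.le u, coeFn_smoothAbsLp hε.le v, hψ2.coeFn_toLp,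
    (hψ.memLp_smul (smoothSignLp ε hε u)).coeFn_toLp, coeFn_smoothSignLp hε u,
    Lp.coeFn_sub v u] with x e1 e2 e3 e4 e5 e6
  rw [hg, hG, e1, e2, e3, e4, e5, e6, Pi.sub_apply]
  have e7 : ⟪ψ x, smoothAbs ε (v x) - ε⟫_ℝ - ⟪ψ x, smoothAbs ε (u x) - ε⟫_ℝ
      - (⟪ψ x • smoothSign ε (u x), v x - u x⟫_ℂ).re
      = ψ x * (smoothAbs ε (v x) - smoothAbs ε (u x)
        - (conj (smoothSign ε (u x)) * (v x - u x)).re) := by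
    rw [RCLike.inner_apply, RCLike.inner_apply, RCLike.inner_apply, Complex.real_smul, map_mul,
      Complex.conj_ofReal, mul_left_comm, Complex.re_ofReal_mul, mul_comm (v x - u x)]
    simp only [conj_trivial]
    ring
  rw [e7, norm_mul, Real.norm_eq_abs, Real.norm_eq_abs, abs_of_nonneg (hψ.nonneg x),
    div_mul_eq_mul_div]
  calc _ ≤ M * (‖v x - u x‖ ^ 2 / ε) := by
        gcongr
        · exact hψ.le x
        · exact abs_smoothAbs_taylor_le hε _ _
    _ = _ := by ring

/-- Along the magnetic heat flow, the integral of the smooth modulus against the backward heat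
kernel of `ℝ⁴` decreases. -/
theorem exists_hasDerivAt_comparison (α : ℝ) (f : L2) (y : R4) (hε : 0 < ε) {s τ : ℝ} (hs : 0 < s)
    (hsτ : s < τ) :
    ∃ D ≤ 0, HasDerivAt
      (fun r => ⟪gaussLp y (τ - r), smoothAbsLp ε hε.le (heatOp α r f)⟫_ℝ) D s := by
  have ha : 0 < τ - s := sub_pos.2 hsτ
  obtain ⟨w, hw, hder⟩ := exists_hasDerivAt_heatOp α f hs
  obtain ⟨M, hψ⟩ := isWeight_gauss ha y
  set u := heatOp α s f with hu
  set N := smoothAbsLp ε hε.le with hN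
  -- by bilinearity, the increment is the sum of the increments in either argument alone and of
  -- a mixed term, which is quadratically small as both arguments are locally Lipschitz
  have hmix : HasDerivAt (fun r => ⟪gaussLp y (τ - r) - gaussLp y (τ - s),
      N (heatOp α r f) - N u⟫_ℝ) 0 s := by
    obtain ⟨C, hC⟩ := exists_norm_gaussLp_sub_le ha y
    obtain ⟨K, hK⟩ := hder.isBigO_sub.bound
    refine hasDerivAt_of_norm_sub_le_sq (C := |C| * K) ?_
    filter_upwards [hK, Metric.closedBall_mem_nhds s (half_pos ha)] with r hr1 hr2
    have hr2' : |r - s| ≤ (τ - s) / 2 := hr2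
    have e1 : τ - r - (τ - s) = -(r - s) := by ring
    have h1 := hC (τ - r) (by rwa [e1, abs_neg])
    rw [e1, abs_neg] at h1
    have h2 : ‖N (heatOp α r f) - N u‖ ≤ K * |r - s| :=
      (norm_smoothAbsLp_sub_le hε.le _ _).trans hr1
    have h3 := norm_inner_le_norm (𝕜 := ℝ) (gaussLp y (τ - r) - gaussLp y (τ - s))
      (N (heatOp α r f) - N u)
    simp only [sub_self, inner_zero_left, sub_zero, smul_zero]
    refine h3.trans ?_
    have h4 : ‖gaussLp y (τ - r) - gaussLp y (τ - s)‖ ≤ |C| * |r - s| :=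
      h1.trans (by gcongr; exact le_abs_self C)
    calc _ ≤ (|C| * |r - s|) * (K * |r - s|) :=
          mul_le_mul h4 h2 (norm_nonneg _) (by positivity)
      _ = |C| * K * (r - s) ^ 2 := by rw [← sq_abs (r - s)]; ring
  have htime : HasDerivAt (fun r => ⟪gaussLp y (τ - r), N u⟫_ℝ)
      (-∫ x, dgauss (τ - s) (x - y) * N u x) s :=
    (hasDerivAt_inner_gaussLp ha y (N u)).comp_const_sub τ s
  have hspace : HasDerivAt (fun r => ⟪gaussLp y (τ - s), N (heatOp α r f)⟫_ℝ)
      (-(⟪smoothSignLp ε hε u, (hψ.memLp_smul w).toLp⟫_ℂ).re) s := by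
    have h1 := hasFDerivAt_inner_smoothAbsLp hψ (memLp_gauss ha y) hε u
    have h2 := h1.comp_hasDerivAt s hder
    rw [gaussLp_of_pos ha]
    refine h2.congr_deriv ?_
    change (⟪(hψ.memLp_smul (smoothSignLp ε hε u)).toLp, -w⟫_ℂ).re = _
    rw [inner_neg_right, Complex.neg_re]
    congr 2
    rw [L2.inner_def, L2.inner_def]
    refine integral_congr_ae ?_
    filter_upwards [(hψ.memLp_smul (smoothSignLp ε hε u)).coeFn_toLp,
      (hψ.memLp_smul w).coeFn_toLp] with x e1 e2
    rw [e1, e2, RCLike.inner_apply, RCLike.inner_apply]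
    simp only [Complex.real_smul, map_mul, Complex.conj_ofReal]
    ring
  refine ⟨_, ?_, ((htime.add hspace).add (hmix.sub_const
    (⟪gaussLp y (τ - s), N u⟫_ℝ))).congr_of_eventuallyEq (Eventually.of_forall fun r => ?_)⟩
  · have h1 := hw.kato hε hψ
    rw [← inner_smoothSignLp hψ hε] at h1
    have h2 : ∫ x, lapl (fun x => gauss (τ - s) (x - y)) x * (smoothAbs ε (u x) - ε)
        = ∫ x, dgauss (τ - s) (x - y) * N u x := by
      refine integral_congr_ae ?_
      filter_upwards [coeFn_smoothAbsLp hε.le u] with x hx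
      rw [lapl_gauss_sub ha.ne', hN, hx]
    rw [h2] at h1
    linarith
  · simp only [Pi.add_apply, inner_sub_left, inner_sub_right]
    ring

/-- The monotone quantity of `exists_hasDerivAt_comparison`, compared between the times `0` and
`t`. -/
theorem inner_gaussLp_smoothAbsLp_le (α : ℝ) (f : L2) (y : R4) (hε : 0 < ε) {t τ : ℝ} (ht : 0 < t)
    (htτ : t < τ) :
    ⟪gaussLp y (τ - t), smoothAbsLp ε hε.le (heatOp α t f)⟫_ℝ
      ≤ ⟪gaussLp y τ, smoothAbsLp ε hε.le f⟫_ℝ := by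
  set F := fun r => ⟪gaussLp y (τ - r), smoothAbsLp ε hε.le (heatOp α r f)⟫_ℝ with hF
  choose! D hD0 hD using fun (s : ℝ) (hs : s ∈ Set.Ioo 0 τ) =>
    exists_hasDerivAt_comparison (ε := ε) α f y hε hs.1 hs.2
  have hanti : AntitoneOn F (Set.Ioo 0 τ) := by
    refine antitoneOn_of_deriv_nonpos (convex_Ioo 0 τ)
      (fun s hs => (hD s hs).continuousAt.continuousWithinAt) (fun s hs => ?_) fun s hs => ?_
    · rw [interior_Ioo] at hs
      exact (hD s hs).differentiableAt.differentiableWithinAt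
    · rw [interior_Ioo] at hs
      rw [(hD s hs).deriv]
      exact hD0 s hs
  have hlim : Tendsto F (𝓝[>] 0) (𝓝 ⟪gaussLp y τ, smoothAbsLp ε hε.le f⟫_ℝ) := by
    refine Tendsto.inner ?_ (((continuous_smoothAbsLp hε.le).tendsto f).comp
      (tendsto_heatOp_apply α f))
    have h1 : Tendsto (fun r : ℝ => τ - r) (𝓝 0) (𝓝 τ) := by
      have : Continuous fun r : ℝ => τ - r := by fun_prop
      simpa using this.tendsto 0
    exact (continuousAt_gaussLp (ht.trans htτ) y).tendsto.comp (h1.mono_left nhdsWithin_le_nhds)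
  refine ge_of_tendsto hlim ?_
  filter_upwards [Ioo_mem_nhdsGT ht] with s hs
  exact hanti ⟨hs.1, hs.2.trans htτ⟩ ⟨ht, htτ⟩ hs.2.le

/-- The modulus of an element of `L²`, as an element of `L²`. -/
def absLp (f : L2) : Lp ℝ 2 (volume : Measure R4) := lipschitzWith_one_norm.compLp norm_zero f

theorem coeFn_absLp (f : L2) : absLp f =ᵐ[volume] fun x => ‖f x‖ :=
  lipschitzWith_one_norm.coeFn_compLp norm_zero f

/-- The diamagnetic inequality, smoothed by the heat kernel at a time `δ > 0`. -/
theorem inner_gaussLp_absLp_heatOp_le (α : ℝ) (f : L2) (y : R4) {t δ : ℝ} (ht : 0 < t)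
    (hδ : 0 < δ) :
    ⟪gaussLp y δ, absLp (heatOp α t f)⟫_ℝ ≤ ⟪gaussLp y (t + δ), absLp f⟫_ℝ := by
  have htδ : 0 < t + δ := by positivity
  have hmain : ∀ ε : ℝ, 0 < ε → ⟪gaussLp y δ, absLp (heatOp α t f)⟫_ℝ
      ≤ ⟪gaussLp y (t + δ), absLp f⟫_ℝ + ε * ∫ x, gauss δ (x - y) := by
    intro ε hε
    have h1 := inner_gaussLp_smoothAbsLp_le α f y hε (τ := t + δ) ht (by linarith)
    rw [add_sub_cancel_left] at h1
    have h2 : ⟪gaussLp y (t + δ), smoothAbsLp ε hε.le f⟫_ℝ ≤ ⟪gaussLp y (t + δ), absLp f⟫_ℝ := by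
      rw [inner_gaussLp htδ, inner_gaussLp htδ]
      refine integral_mono_ae (MemLp.integrable_mul (memLp_gauss htδ y) (Lp.memLp _))
        (MemLp.integrable_mul (memLp_gauss htδ y) (Lp.memLp _)) ?_
      filter_upwards [coeFn_absLp f, coeFn_smoothAbsLp hε.le f] with x e1 e2
      simp only [e1, e2]
      refine mul_le_mul_of_nonneg_left ?_ (gauss_nonneg _ _)
      have := smoothAbs_le_norm_add hε.le (f x)
      linarith
    have h3 : ⟪gaussLp y δ, absLp (heatOp α t f)⟫_ℝ
        ≤ ⟪gaussLp y δ, smoothAbsLp ε hε.le (heatOp α t f)⟫_ℝ + ε * ∫ x, gauss δ (x - y) := by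
      have i1 : ∀ h : Lp ℝ 2 (volume : Measure R4), Integrable fun x => gauss δ (x - y) * h x :=
        fun h => MemLp.integrable_mul (memLp_gauss hδ y) (Lp.memLp h)
      rw [inner_gaussLp hδ, inner_gaussLp hδ, ← integral_const_mul,
        ← integral_add (i1 _) ((integrable_gauss hδ y).const_mul ε)]
      refine integral_mono_ae (i1 _) ((i1 _).add ((integrable_gauss hδ y).const_mul ε)) ?_
      filter_upwards [coeFn_absLp (heatOp α t f), coeFn_smoothAbsLp hε.le (heatOp α t f)]
        with x e1 e2
      simp only [e1, e2]
      have := norm_le_smoothAbs ε (heatOp α t f x)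
      nlinarith [gauss_nonneg δ (x - y)]
    linarith
  have hlim : Tendsto (fun ε : ℝ => ⟪gaussLp y (t + δ), absLp f⟫_ℝ + ε * ∫ x, gauss δ (x - y))
      (𝓝[>] 0) (𝓝 (⟪gaussLp y (t + δ), absLp f⟫_ℝ)) := by
    have : Continuous fun ε : ℝ =>
      ⟪gaussLp y (t + δ), absLp f⟫_ℝ + ε * ∫ x, gauss δ (x - y) := by fun_prop
    have h := this.tendsto 0
    rw [zero_mul, add_zero] at h
    exact h.mono_left nhdsWithin_le_nhds
  refine ge_of_tendsto hlim ?_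
  filter_upwards [self_mem_nhdsWithin] with ε hε
  exact hmain ε hε

/-- Up to a constant, the Gaussian at time `r²` dominates the normalised indicator of a ball of
radius `r`. -/
theorem average_le_inner_gaussLp (h : L2) (y : R4) {r : ℝ} (hr : 0 < r) :
    ⨍ x in Metric.closedBall y r, ‖h x‖
      ≤ Real.exp (1 / 4) / volume.real (Metric.ball (0 : R4) 1)
        * ⟪gaussLp y (r ^ 2), absLp h⟫_ℝ := by
  set V := volume.real (Metric.ball (0 : R4) 1) with hV
  have hV0 : 0 < V := ENNReal.toReal_pos
    (Metric.measure_ball_pos _ _ one_pos).ne' measure_ball_lt_top.ne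
  have hvol : volume.real (Metric.closedBall y r) = r ^ 4 * V := by
    rw [Measure.addHaar_real_closedBall _ _ hr.le]; simp [hV]
  have hi : Integrable fun x => gauss (r ^ 2) (x - y) * ‖h x‖ :=
    MemLp.integrable_mul (memLp_gauss (pow_pos hr 2) y) (Lp.memLp h).norm
  have h1 : ⟪gaussLp y (r ^ 2), absLp h⟫_ℝ = ∫ x, gauss (r ^ 2) (x - y) * ‖h x‖ := by
    rw [inner_gaussLp (pow_pos hr 2)]
    refine integral_congr_ae ?_
    filter_upwards [coeFn_absLp h] with x hx
    rw [hx]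
  have h2 : ((r ^ 4)⁻¹ * Real.exp (-(1 / 4))) * ∫ x in Metric.closedBall y r, ‖h x‖
      ≤ ∫ x, gauss (r ^ 2) (x - y) * ‖h x‖ := by
    rw [← integral_const_mul]
    refine le_trans (integral_mono_of_nonneg (ae_of_all _ fun x => by positivity)
      hi.integrableOn ?_) (setIntegral_le_integral hi
      (ae_of_all _ fun x => mul_nonneg (gauss_nonneg _ _) (norm_nonneg _)))
    filter_upwards [ae_restrict_mem measurableSet_closedBall] with x hx
    refine mul_le_mul_of_nonneg_right ?_ (norm_nonneg _)
    rw [mem_closedBall_iff_norm] at hx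
    unfold gauss
    rw [← pow_mul]
    refine mul_le_mul_of_nonneg_left (Real.exp_le_exp.2 ?_) (by positivity)
    rw [neg_div, neg_le_neg_iff, div_le_div_iff₀ (by positivity) (by norm_num)]
    have : ‖x - y‖ ^ 2 ≤ r ^ 2 := by gcongr
    linarith
  rw [setAverage_eq, hvol, h1, smul_eq_mul]
  have h3 : (r ^ 4 * V)⁻¹ * ∫ x in Metric.closedBall y r, ‖h x‖
      = Real.exp (1 / 4) / V
        * (((r ^ 4)⁻¹ * Real.exp (-(1 / 4))) * ∫ x in Metric.closedBall y r, ‖h x‖) := by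
    have : Real.exp (1 / 4) * Real.exp (-(1 / 4)) = 1 := by rw [← Real.exp_add]; simp
    calc _ = (r ^ 4 * V)⁻¹ * (Real.exp (1 / 4) * Real.exp (-(1 / 4)))
          * ∫ x in Metric.closedBall y r, ‖h x‖ := by rw [this, mul_one]
      _ = _ := by field_simp
  rw [h3]
  gcongr

/-- The diamagnetic inequality, up to a constant. -/
theorem ae_norm_heatOp_apply_le (α : ℝ) (f : L2) {t : ℝ} (ht : 0 < t) :
    ∀ᵐ y, ‖heatOp α t f y‖ ≤ ∫ x, Real.exp (1 / 4) / volume.real (Metric.ball (0 : R4) 1)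
      * gauss t (x - y) * ‖f x‖ := by
  set C := Real.exp (1 / 4) / volume.real (Metric.ball (0 : R4) 1) with hC
  have hloc : LocallyIntegrable (fun x => ‖heatOp α t f x‖) (volume : Measure R4) :=
    (Lp.memLp (heatOp α t f)).norm.locallyIntegrable (by norm_num)
  filter_upwards [IsUnifLocDoublingMeasure.ae_tendsto_average (volume : Measure R4) hloc 1]
    with y hy
  have h1 := hy (ι := ℝ) (l := 𝓝[>] 0) (fun _ => y) id tendsto_id
    (by filter_upwards [self_mem_nhdsWithin] with r hr
        have : (0 : ℝ) < r := hr
        exact Metric.mem_closedBall_self (by simpa using this.le))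
  have h2 : Tendsto (fun r : ℝ => C * ⟪gaussLp y (t + r ^ 2), absLp f⟫_ℝ) (𝓝[>] 0)
      (𝓝 (C * ⟪gaussLp y t, absLp f⟫_ℝ)) := by
    have h3 : Tendsto (fun r : ℝ => t + r ^ 2) (𝓝 0) (𝓝 t) := by
      have : Continuous fun r : ℝ => t + r ^ 2 := by fun_prop
      simpa using this.tendsto 0
    exact (((continuousAt_gaussLp ht y).tendsto.comp
      (h3.mono_left nhdsWithin_le_nhds)).inner tendsto_const_nhds).const_mul C
  have h4 : ‖heatOp α t f y‖ ≤ C * ⟪gaussLp y t, absLp f⟫_ℝ := by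
    refine le_of_tendsto_of_tendsto h1 h2 ?_
    filter_upwards [self_mem_nhdsWithin] with r hr
    refine (average_le_inner_gaussLp (heatOp α t f) y hr).trans ?_
    exact mul_le_mul_of_nonneg_left (inner_gaussLp_absLp_heatOp_le α f y ht (pow_pos hr 2))
      (by positivity)
  refine h4.trans_eq ?_
  rw [inner_gaussLp ht, ← integral_const_mul]
  refine integral_congr_ae ?_
  filter_upwards [coeFn_absLp f] with x hx
  rw [hx, mul_assoc]

end Comparison

end AharonovBohm

end

theorem theorem1p4 (α : ℝ) :
    ∃ (C : ℝ) (K : ℝ → AharonovBohm.R4 → AharonovBohm.R4 → ℂ), ∀ t : ℝ, 0 < t →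
      AharonovBohm.IsIntegralKernel (AharonovBohm.heatOp α t) (K t) ∧
      ∀ x y : AharonovBohm.R4,
        ‖K t x y‖ ≤ C * t ^ (-2 : ℤ) * Real.exp (-‖x - y‖ ^ 2 / (4 * t)) := by
  open AharonovBohm in
  set C := Real.exp (1 / 4) / volume.real (Metric.ball (0 : R4) 1) with hC
  have hker : ∀ t : ℝ, 0 < t → ∃ K : R4 → R4 → ℂ, IsIntegralKernel (heatOp α t) K ∧
      ∀ x y, ‖K x y‖ ≤ C * gauss t (y - x) := by
    intro t ht
    have hq : ∀ x : R4, MemLp (fun y => C * gauss t (y - x)) 2 (volume : Measure R4) := fun x =>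
      (memLp_gauss ht x).const_mul C
    have hnorm : ∀ x, ‖(hq x).toLp‖ ≤ ‖(hq 0).toLp‖ := by
      intro x
      rw [Lp.norm_toLp, Lp.norm_toLp]
      have h := eLpNorm_comp_measurePreserving (p := 2) (hq 0).1
        (measurePreserving_sub_right (volume : Measure R4) x)
      have e : (fun y => C * gauss t (y - 0)) ∘ (fun y => y - x)
          = fun y : R4 => C * gauss t (y - x) := by
        funext y; simp
      rw [e] at h
      rw [h]
    have hqm : Measurable (Function.uncurry fun x y : R4 => C * gauss t (y - x)) :=
      (continuous_const.mul ((continuous_gauss t).comp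
        (continuous_snd.sub continuous_fst))).measurable
    obtain ⟨K, hK, hle, hKf⟩ := exists_kernel_norm_le (heatOp α t) hqm
      (fun x y => mul_nonneg (by positivity) (gauss_nonneg _ _)) hq hnorm
      fun f => ae_norm_heatOp_apply_le α f ht
    exact ⟨K, ⟨hK, hKf⟩, hle⟩
  choose! K hK1 hK2 using hker
  refine ⟨C, K, fun t ht => ⟨hK1 t ht, fun x y => (hK2 t ht x y).trans_eq ?_⟩⟩
  rw [gauss, norm_sub_rev, mul_assoc]
  congr 2
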